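/- **Setting.** Let $d\ge 1$, $\alpha,\xi\ge 0$ be integers and $T>0$. *Wasserstein space.* Let $\mathcal P_2(\mathbb S^{d-1})$ be the set of Borel probability measures on the unit sphere of $\mathbb R^d$ (all of them have finite second moment), and let $\mathrm W_2$ be the $2$-Wasserstein distance for the geodesic distance, $\mathrm W_2^2(\mu,\nu)=\inf_\gamma\int \arccos(\langle x,y\rangle)^2\,d\gamma(x,y)$, where $\gamma$ runs over the couplings of $\mu$ and $\nu$. A curve $u:[0,T]\to\mathcal P_2(\mathbb S^{d-1})$ belongs to $AC^2([0,T];\mathcal P_2(\mathbb S^{d-1}))$ if there is $m\in L^2(0,T)$ with $\mathrm W_2(u(s),u(r))\le\int_s^r m(t)\,dt$ for all $0\le s\le r\le T$. *Weights.* Let $f:\mathbb R^\alpha\times[0,T]\to\mathbb R^\alpha$ and $g:\mathbb R^\alpha\times[0,T]\to\mathbb R^{\alpha\times\xi}$ be Borel functions such that for each $R$ there are $a\in L^1(0,T)$, $b\in L^2(0,T)$ with $|f(\theta,t)|\le a(t)$ and $|g(\theta,t)|\le b(t)$ for a.e. $t$ and all $|\theta|\le R$. Put $G=\frac12 gg^\top$.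 Let $t\mapsto\Theta_t$ be a narrowly continuous curve of Borel probability measures on $\mathbb R^\alpha$, $t\in[0,T]$, that is a weak solution of $\partial_t\Theta_t+\operatorname{div}_\theta(\Theta_t f)-\operatorname{div}_\theta\operatorname{div}_\theta(\Theta_t G)=0$ (the equation for the law of $d\theta_t=f(\theta_t,t)\,dt+g(\theta_t,t)\,dW_t$), that is, $$\int_0^T\!\!\int_{\mathbb R^\alpha}\big(\partial_t\psi+\langle\nabla_\theta\psi,f\rangle+\nabla^2_\theta\psi:G\big)\,d\Theta_t\,dt=0\qquad\text{for all }\psi\in C_c^\infty(\mathbb R^\alpha\times(0,T)).$$ *Energy.* Let $\mathscr K:\mathbb S^{d-1}\times\mathbb S^{d-1}\times\mathbb R^\alpha\to\mathbb R$ satisfy: the supports of all the functions $\mathscr K(x,y,\cdot)$ lie in one compact subset of $\mathbb R^\alpha$; $\mathscr K(\cdot,\cdot,\theta)\in C^{1,1}(\mathbb S^{d-1}\times\mathbb S^{d-1})$ for each $\theta$; $\mathscr K(x,y,\cdot)\in C^2(\mathbb R^\alpha)$ for all $x,y$, with $\sup_{x,y,\theta}|\nabla_\theta\mathscr K|<\infty$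 and $\sup_{x,y,\theta}|\nabla_\theta^2\mathscr K|<\infty$; and $\mathscr K(x,y,\theta)=\mathscr K(y,x,\theta)$. Put $$\mathcal E(\mu,t)=\frac12\int_{\mathbb R^\alpha}\int_{\mathbb S^{d-1}}\int_{\mathbb S^{d-1}}\mathscr K(x,y,\theta)\,d\mu(y)\,d\mu(x)\,d\Theta_t(\theta).$$ *Scheme.* Fix $u_0\in\mathcal P_2(\mathbb S^{d-1})$. For a partition $\tau=\{0=t_0<t_1<\dots<t_N=T\}$ with mesh $|\tau|=\max_k(t_k-t_{k-1})$ and penalization parameters $\sigma_1,\dots,\sigma_N>0$, a minimizing movement sequence is any sequence with $u_\tau^0=u_0$ and $$u_\tau^k\in\operatorname*{argmin}_{u\in\mathcal P_2(\mathbb S^{d-1})}\Big\{\frac{\mathrm W_2^2(u,u_\tau^{k-1})}{2\sigma_k}+\mathcal E(u,t_k)\Big\},\qquad k=1,\dots,N.$$ Its piecewise constant interpolation is $u_\tau(0)=u_0$ and $u_\tau(t)=u_\tau^k$ for $t\in(t_{k-1},t_k]$. **Theorem.** Let $(\tau_n)_{n\in\mathbb N}$ be partitions of $[0,T]$ with $|\tau_n|\to0$.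 For each $n$ let $(u_{\tau_n}^k)_k$ be a minimizing movement sequence, where * either $\sigma_k=t_k-t_{k-1}$ for every partition $\tau_n$ and every $k$, * or $\sigma_k=|\tau_n|$ for every partition $\tau_n$ and every $k$, and there is $\Lambda$, independent of $n$, such that for all $0\le s\le r\le T$ the interval $(s,r]$ contains at most $\Lambda\,(1+(r-s)/|\tau_n|)$ points of $\tau_n$ (as is the case for uniform partitions). Then the discrete speeds are uniformly bounded in $L^2$: there is $C$ such that for every $n$ $$\sum_{k}\sigma_k\Big(\frac{\mathrm W_2(u_{\tau_n}^k,u_{\tau_n}^{k-1})}{\sigma_k}\Big)^2\le C .$$ Moreover, there are a subsequence (not relabeled) and a curve $u\in AC^2([0,T];\mathcal P_2(\mathbb S^{d-1}))$ such that $u_{\tau_n}(t)\rightharpoonup u(t)$ narrowly for every $t\in[0,T]$. -/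

import Mathlib

open MeasureTheory Set Filter Topology
open scoped ENNReal ContDiff

noncomputable section

/-- The unit sphere `S^{d-1}` of `ℝ^d`. -/
abbrev UnitSphere (d : ℕ) : Type := Metric.sphere (0 : EuclideanSpace ℝ (Fin d)) 1

/-- Borel probability measures on the sphere, with the narrow topology. The sphere is compact, so
these are all the measures with finite second moment. -/
abbrev SphereProb (d : ℕ) : Type := ProbabilityMeasure (UnitSphere d)

/-! ### The Wasserstein distance on the sphere -/

/-- `γ` is a transport plan between `μ` and `ν`. -/
def IsTransportPlan {d : ℕ} (μ ν : SphereProb d) (γ : Measure (UnitSphere d × UnitSphere d)) :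
    Prop :=
  γ.map Prod.fst = (μ : Measure (UnitSphere d)) ∧ γ.map Prod.snd = (ν : Measure (UnitSphere d))

/-- The geodesic distance of the round sphere: the angle between the two unit vectors. -/
def geodesicDist {d : ℕ} (x y : UnitSphere d) : ℝ :=
  InnerProductGeometry.angle (x : EuclideanSpace ℝ (Fin d)) (y : EuclideanSpace ℝ (Fin d))

/-- The squared Wasserstein distance, as an infimum over transport plans. -/
def wassersteinSq {d : ℕ} (μ ν : SphereProb d) : ℝ≥0∞ :=
  ⨅ (γ : Measure (UnitSphere d × UnitSphere d)) (_ : IsTransportPlan μ ν γ),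
    ∫⁻ z, ENNReal.ofReal (geodesicDist z.1 z.2 ^ 2) ∂γ

/-- The `2`-Wasserstein distance of the round sphere. -/
def W2 {d : ℕ} (μ ν : SphereProb d) : ℝ := Real.sqrt (wassersteinSq μ ν).toReal

/-- The squared distance is finite, so that `toReal` in `W2` loses nothing. -/
theorem wassersteinSq_lt_top {d : ℕ} (μ ν : SphereProb d) : wassersteinSq μ ν < ⊤ := by
  have hplan : IsTransportPlan μ ν
      ((μ : Measure (UnitSphere d)).prod (ν : Measure (UnitSphere d))) := by
    constructor
    · rw [Measure.map_fst_prod]; simp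
    · rw [Measure.map_snd_prod]; simp
  refine lt_of_le_of_lt (iInf₂_le _ hplan) ?_
  refine lt_of_le_of_lt (lintegral_mono (g := fun _ => ENNReal.ofReal (Real.pi ^ 2)) ?_) ?_
  · intro z
    apply ENNReal.ofReal_le_ofReal
    exact pow_le_pow_left₀ (InnerProductGeometry.angle_nonneg _ _)
      (InnerProductGeometry.angle_le_pi _ _) 2
  · simp

/-- `u ∈ AC²([0,T]; (P_2(S^{d-1}), W_2))`: the increments of `u` are bounded by the integral of a
function in `L²(0,T)`. -/
def IsAC2 {d : ℕ} (T : ℝ) (u : ℝ → SphereProb d) : Prop :=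
  ∃ m : ℝ → ℝ, MemLp m 2 (volume.restrict (Icc 0 T)) ∧
    ∀ s r : ℝ, 0 ≤ s → s ≤ r → r ≤ T → W2 (u s) (u r) ≤ ∫ t in s..r, m t

/-! ### The evolution of the weights -/

/-- `F ∈ L^p(0,T; L^∞_loc(ℝ^α))`, with pointwise suprema over balls, since `F (·, t)` is going to
be integrated against arbitrary probability measures. -/
def IsLpLocBounded {α : ℕ} {V : Type*} [NormedAddCommGroup V] (p : ℝ≥0∞) (T : ℝ)
    (F : EuclideanSpace ℝ (Fin α) → ℝ → V) : Prop :=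
  ∀ R : ℝ, ∃ a : ℝ → ℝ, MemLp a p (volume.restrict (Icc 0 T)) ∧
    ∀ᵐ t ∂(volume.restrict (Icc 0 T)), ∀ θ, ‖θ‖ ≤ R → ‖F θ t‖ ≤ a t

/-- The standing assumptions on the drift `f` and the noise coefficient `g` of the stochastic
differential equation `dθ = f(θ,t) dt + g(θ,t) dW_t`, on the time interval `[0,T]`. -/
structure AdmissibleCoefficients {α ξ : ℕ} (T : ℝ)
    (f : EuclideanSpace ℝ (Fin α) → ℝ → EuclideanSpace ℝ (Fin α))
    (g : EuclideanSpace ℝ (Fin α) → ℝ → Matrix (Fin α) (Fin ξ) ℝ) : Prop where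
  drift_measurable : Measurable (Function.uncurry f)
  noise_measurable : ∀ i j, Measurable (fun z : EuclideanSpace ℝ (Fin α) × ℝ => g z.1 z.2 i j)
  drift_bound : IsLpLocBounded 1 T f
  noise_bound : ∀ i j, IsLpLocBounded 2 T (fun θ t => g θ t i j)

/-- The diffusion matrix `G = ½ g gᵀ`. -/
def diffusionMatrix {α ξ : ℕ}
    (g : EuclideanSpace ℝ (Fin α) → ℝ → Matrix (Fin α) (Fin ξ) ℝ)
    (θ : EuclideanSpace ℝ (Fin α)) (t : ℝ) : Matrix (Fin α) (Fin α) ℝ :=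
  (1 / 2 : ℝ) • (g θ t * (g θ t).transpose)

/-- `∂_t ψ + ⟨∇_θ ψ, f⟩ + ∇²_θ ψ : G` at `(θ, t)`. -/
def kolmogorovOperator {α ξ : ℕ}
    (f : EuclideanSpace ℝ (Fin α) → ℝ → EuclideanSpace ℝ (Fin α))
    (g : EuclideanSpace ℝ (Fin α) → ℝ → Matrix (Fin α) (Fin ξ) ℝ)
    (ψ : EuclideanSpace ℝ (Fin α) × ℝ → ℝ) (θ : EuclideanSpace ℝ (Fin α)) (t : ℝ) : ℝ :=
  deriv (fun s => ψ (θ, s)) t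
    + fderiv ℝ (fun η => ψ (η, t)) θ (f θ t)
    + ∑ i, ∑ j, fderiv ℝ (fun η => fderiv ℝ (fun ζ => ψ (ζ, t)) η) θ
        (EuclideanSpace.single i 1) (EuclideanSpace.single j 1) * diffusionMatrix g θ t i j

/-- `Θ` is a narrowly continuous weak solution on `[0,T]` of
`∂_t Θ + div (Θ f) - div div (Θ G) = 0`, the equation for the law of `dθ = f dt + g dW_t`. -/
structure IsWeightFlow {α ξ : ℕ} (T : ℝ)
    (f : EuclideanSpace ℝ (Fin α) → ℝ → EuclideanSpace ℝ (Fin α))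
    (g : EuclideanSpace ℝ (Fin α) → ℝ → Matrix (Fin α) (Fin ξ) ℝ)
    (Θ : ℝ → ProbabilityMeasure (EuclideanSpace ℝ (Fin α))) : Prop where
  continuousOn : ContinuousOn Θ (Icc 0 T)
  weak_eq : ∀ ψ : EuclideanSpace ℝ (Fin α) × ℝ → ℝ, ContDiff ℝ ∞ ψ → HasCompactSupport ψ →
    tsupport ψ ⊆ univ ×ˢ Ioo 0 T →
    ∫ t in Ioo 0 T, ∫ θ, kolmogorovOperator f g ψ θ t
      ∂(Θ t : Measure (EuclideanSpace ℝ (Fin α))) = 0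

/-! ### The interaction energy -/

/-- `h ∈ C^{1,1}(S^{d-1} × S^{d-1})`: `h` is the restriction of a `C^{1,1}` function of the ambient
space. -/
def IsC11 {d : ℕ} (h : UnitSphere d → UnitSphere d → ℝ) : Prop :=
  ∃ F : EuclideanSpace ℝ (Fin d) × EuclideanSpace ℝ (Fin d) → ℝ, ContDiff ℝ 1 F ∧
    (∃ L, LipschitzWith L (fderiv ℝ F)) ∧
    ∀ x y : UnitSphere d, F ((x : EuclideanSpace ℝ (Fin d)), (y : EuclideanSpace ℝ (Fin d))) = h x y

/-- The assumptions on the interaction kernel. -/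
structure AdmissibleKernel {d α : ℕ}
    (K : UnitSphere d → UnitSphere d → EuclideanSpace ℝ (Fin α) → ℝ) : Prop where
  compact_support : ∃ C : Set (EuclideanSpace ℝ (Fin α)), IsCompact C ∧
    ∀ x y, tsupport (K x y) ⊆ C
  regular_sphere : ∀ θ, IsC11 (fun x y => K x y θ)
  regular_weight : ∀ x y, ContDiff ℝ 2 (K x y)
  derivative_bounds : ∃ B : ℝ, ∀ x y θ,
    ‖fderiv ℝ (K x y) θ‖ ≤ B ∧ ‖fderiv ℝ (fderiv ℝ (K x y)) θ‖ ≤ B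
  symmetric : ∀ x y θ, K x y θ = K y x θ

/-- The time-dependent interaction energy `ℰ(μ, t)`. -/
def interactionEnergy {d α : ℕ}
    (K : UnitSphere d → UnitSphere d → EuclideanSpace ℝ (Fin α) → ℝ)
    (Θ : ℝ → ProbabilityMeasure (EuclideanSpace ℝ (Fin α))) (μ : SphereProb d) (t : ℝ) : ℝ :=
  (1 / 2 : ℝ) * ∫ θ, ∫ x, ∫ y, K x y θ ∂(μ : Measure (UnitSphere d))
    ∂(μ : Measure (UnitSphere d)) ∂(Θ t : Measure (EuclideanSpace ℝ (Fin α)))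

/-! ### Partitions and the minimizing movement scheme -/

/-- A partition `0 = t_0 < t_1 < ⋯ < t_N = T`. The values `pt k` for `k > N` play no role. -/
structure TimePartition (T : ℝ) where
  N : ℕ
  pt : ℕ → ℝ
  pt_zero : pt 0 = 0
  pt_last : pt N = T
  pt_lt : ∀ k < N, pt k < pt (k + 1)

namespace TimePartition

variable {T : ℝ}

/-- The mesh `|τ| = max_k (t_k - t_{k-1})`. -/
def mesh (τ : TimePartition T) : ℝ := ⨆ k : Fin τ.N, (τ.pt (k + 1) - τ.pt k)

/-- The number of points `t_k`, `1 ≤ k ≤ N`, in the interval `(s, r]`. -/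
def countIoc (τ : TimePartition T) (s r : ℝ) : ℕ :=
  Set.ncard {k : ℕ | k < τ.N ∧ τ.pt (k + 1) ∈ Ioc s r}

/-- The piecewise constant interpolation of `U 0, …, U N`: at time `t` it takes the value `U k` for
the first `k` with `t ≤ t_k`. -/
def interp {d : ℕ} (τ : TimePartition T) (U : ℕ → SphereProb d) (t : ℝ) : SphereProb d :=
  U (sInf {k : ℕ | t ≤ τ.pt k})

theorem pt_lt_of_lt (τ : TimePartition T) {i j : ℕ} (hij : i < j) (hj : j ≤ τ.N) :
    τ.pt i < τ.pt j := by
  induction j, hij using Nat.le_induction with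
  | base => exact τ.pt_lt i hj
  | succ j hij ih => exact (ih (by omega)).trans (τ.pt_lt j hj)

theorem interp_zero {d : ℕ} (τ : TimePartition T) (U : ℕ → SphereProb d) :
    τ.interp U 0 = U 0 := by
  have h : sInf {k : ℕ | (0 : ℝ) ≤ τ.pt k} = 0 :=
    Nat.sInf_eq_zero.2 (Or.inl (by simp [τ.pt_zero]))
  rw [interp, h]

theorem interp_of_mem {d : ℕ} (τ : TimePartition T) (U : ℕ → SphereProb d) {k : ℕ}
    (hk : k < τ.N) {t : ℝ} (ht : t ∈ Ioc (τ.pt k) (τ.pt (k + 1))) :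
    τ.interp U t = U (k + 1) := by
  have hmem : k + 1 ∈ {j : ℕ | t ≤ τ.pt j} := ht.2
  have h : sInf {j : ℕ | t ≤ τ.pt j} = k + 1 := by
    apply le_antisymm (Nat.sInf_le hmem)
    by_contra hlt
    have h1 : t ≤ τ.pt (sInf {j : ℕ | t ≤ τ.pt j}) := Nat.sInf_mem ⟨_, hmem⟩
    have h2 : τ.pt (sInf {j : ℕ | t ≤ τ.pt j}) ≤ τ.pt k := by
      rcases (show sInf {j : ℕ | t ≤ τ.pt j} ≤ k by omega).lt_or_eq with h3 | h3
      · exact (τ.pt_lt_of_lt h3 hk.le).le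
      · rw [h3]
    exact absurd ht.1 (not_lt.2 (h1.trans h2))
  rw [interp, h]

end TimePartition

/-- `U 0 = u₀` and, for `k < N`, `U (k+1)` minimizes
`ν ↦ W_2²(ν, U k) / (2 σ_k) + ℰ(ν, t_{k+1})` over all probability measures on the sphere. -/
structure IsMinimizingMovement {d : ℕ} {T : ℝ} (E : SphereProb d → ℝ → ℝ)
    (τ : TimePartition T) (σ : ℕ → ℝ) (u₀ : SphereProb d) (U : ℕ → SphereProb d) : Prop where
  init : U 0 = u₀
  minimal : ∀ k < τ.N, ∀ ν : SphereProb d,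
    W2 (U (k + 1)) (U k) ^ 2 / (2 * σ k) + E (U (k + 1)) (τ.pt (k + 1)) ≤
      W2 ν (U k) ^ 2 / (2 * σ k) + E ν (τ.pt (k + 1))

end

/-!
The scheme is a minimizing movement for an energy that depends on time only through the weights
`Θ`, so the proof has an energy estimate and a compactness argument.

*Energy estimate.* Comparing `U (k+1)` with `U k` gives
`W₂²(U (k+1), U k) / (2 σ_k) ≤ ℰ(U k, t_{k+1}) - ℰ(U (k+1), t_{k+1})`. The sum telescopes up to the
increments of `ℰ(μ, ·)`, which are dominated, uniformly in `μ`, by the integral of an `L¹` function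
(`exists_energy_bounds`). Here `ℰ(μ, t)` is half the mean under `Θ_t` of the averaged kernel
`meanKernel K μ`, a compactly supported function of `θ` whose first and second differences are
bounded independently of `μ`. These bounds survive mollification (`exists_contDiff_approx`), and for
a smooth function they are all the Kolmogorov operator sees, since
`∇²ψ : ½ g gᵀ = ½ ∑ₖ ∇²ψ(gₖ, gₖ)` (`abs_generator_le`); no derivative of an integral in the sphere
variables is needed. Testing the weak equation with `ψ(θ) χ(t)`, for `χ` a smooth
approximation of the indicator of `[s, t]`, turns the bound on the generator into the bound on the
increments (`abs_sub_le_integral_of_weak_deriv`).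

*Compactness.* The discrete speed of step `k` is spread over `(t_k, t_k + σ_k]`. In both regimes of
penalization boundedly many of these intervals overlap, so the resulting functions are bounded in
`L²(ℝ)`, and their integrals over `[s, r + |τ|]` bound the `W₂`-increments of the interpolations
over `[s, r]`. Narrow compactness of the probability measures on the sphere gives convergence at
rational times, and equicontinuity gives it at all times. Any weak limit of the speeds is a speed of
the limit curve, because `W₂` is narrowly lower semicontinuous (`W2_le_of_tendsto`). The facts used
about `W₂`, namely existence of optimal plans, the triangle inequality and lower semicontinuity,
come from compactness of the set of plans and from gluing by disintegration.
-/

/-! ### The Wasserstein distance on the sphere -/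

section Wasserstein

variable {d : ℕ}

theorem continuous_geodesicDist :
    Continuous (fun z : UnitSphere d × UnitSphere d => geodesicDist z.1 z.2) := by
  have h : (fun z : UnitSphere d × UnitSphere d => geodesicDist z.1 z.2) = fun z =>
      Real.arccos (inner ℝ (z.1 : EuclideanSpace ℝ (Fin d)) (z.2 : EuclideanSpace ℝ (Fin d))) := by
    ext z
    simp [geodesicDist, InnerProductGeometry.angle]
  rw [h]
  exact Real.continuous_arccos.comp (by fun_prop)

theorem geodesicDist_nonneg (x y : UnitSphere d) : 0 ≤ geodesicDist x y :=
  InnerProductGeometry.angle_nonneg _ _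

theorem geodesicDist_comm (x y : UnitSphere d) : geodesicDist x y = geodesicDist y x :=
  InnerProductGeometry.angle_comm _ _

theorem geodesicDist_triangle (x y z : UnitSphere d) :
    geodesicDist x z ≤ geodesicDist x y + geodesicDist y z :=
  InnerProductGeometry.angle_le_angle_add_angle _ _ _

theorem geodesicDist_self (x : UnitSphere d) : geodesicDist x x = 0 :=
  InnerProductGeometry.angle_self (by
    intro h
    have := norm_eq_of_mem_sphere x
    rw [h] at this
    simp at this)

theorem eq_of_geodesicDist_eq_zero {x y : UnitSphere d} (h : geodesicDist x y = 0) : x = y := by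
  have h1 := (InnerProductGeometry.inner_eq_mul_norm_iff_angle_eq_zero
    (x := (x : EuclideanSpace ℝ (Fin d))) (y := (y : EuclideanSpace ℝ (Fin d)))
    (by intro h; have := norm_eq_of_mem_sphere x; rw [h] at this; simp at this)
    (by intro h; have := norm_eq_of_mem_sphere y; rw [h] at this; simp at this)).2 h
  simp only [norm_eq_of_mem_sphere, mul_one] at h1
  exact Subtype.ext ((inner_eq_one_iff_of_norm_eq_one (norm_eq_of_mem_sphere x)
    (norm_eq_of_mem_sphere y)).1 h1)

/-- The transport cost of a plan. -/
noncomputable def planCost (γ : Measure (UnitSphere d × UnitSphere d)) : ℝ≥0∞ :=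
  ∫⁻ z, ENNReal.ofReal (geodesicDist z.1 z.2 ^ 2) ∂γ

theorem measurable_planCost_integrand :
    Measurable (fun z : UnitSphere d × UnitSphere d =>
      ENNReal.ofReal (geodesicDist z.1 z.2 ^ 2)) :=
  (ENNReal.continuous_ofReal.comp (continuous_geodesicDist.pow 2)).measurable

theorem wassersteinSq_le_planCost {μ ν : SphereProb d}
    {γ : Measure (UnitSphere d × UnitSphere d)} (h : IsTransportPlan μ ν γ) :
    wassersteinSq μ ν ≤ planCost γ := iInf₂_le γ h

theorem exists_plan_lt {μ ν : SphereProb d} {b : ℝ≥0∞} (h : wassersteinSq μ ν < b) :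
    ∃ γ : ProbabilityMeasure (UnitSphere d × UnitSphere d),
      IsTransportPlan μ ν γ ∧ planCost (γ : Measure (UnitSphere d × UnitSphere d)) < b := by
  simp only [wassersteinSq, iInf_lt_iff] at h
  obtain ⟨γ, hγ, hb⟩ := h
  have : IsProbabilityMeasure γ := by
    have h1 : IsProbabilityMeasure (γ.map Prod.fst) := by rw [hγ.1]; infer_instance
    exact Measure.isProbabilityMeasure_of_map Prod.fst
  exact ⟨⟨γ, this⟩, hγ, hb⟩

/-- Transport plans of asymptotically bounded cost accumulate at a plan of the limit measures:
the set of all plans is compact, and marginals and cost are narrowly continuous. -/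
theorem exists_plan_of_tendsto {ι : Type*} {l : Filter ι} [l.NeBot] {μ ν : ι → SphereProb d}
    {μ₀ ν₀ : SphereProb d} (hμ : Tendsto μ l (𝓝 μ₀)) (hν : Tendsto ν l (𝓝 ν₀))
    {b : ι → ℝ≥0∞} {b₀ : ℝ≥0∞} (hb : Tendsto b l (𝓝 b₀))
    (h : ∀ᶠ i in l, wassersteinSq (μ i) (ν i) < b i) :
    ∃ γ : Measure (UnitSphere d × UnitSphere d), IsTransportPlan μ₀ ν₀ γ ∧ planCost γ ≤ b₀ := by
  -- along an ultrafilter the chosen plans converge outright, without extracting a subsequence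
  obtain ⟨F, hF⟩ := Ultrafilter.exists_le l
  have : Nonempty (UnitSphere d) := μ₀.nonempty
  have hex : ∀ i, ∃ γ : ProbabilityMeasure (UnitSphere d × UnitSphere d),
      wassersteinSq (μ i) (ν i) < b i → IsTransportPlan (μ i) (ν i) γ ∧
        planCost (γ : Measure (UnitSphere d × UnitSphere d)) < b i := by
    intro i
    by_cases hi : wassersteinSq (μ i) (ν i) < b i
    · obtain ⟨γ, hγ⟩ := exists_plan_lt hi
      exact ⟨γ, fun _ => hγ⟩
    · exact ⟨⟨Measure.dirac (Classical.arbitrary _), inferInstance⟩, fun h => absurd h hi⟩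
  choose γ hγ using hex
  obtain ⟨γ₀, -, hγ₀⟩ := isCompact_univ.ultrafilter_le_nhds (F.map γ) (by simp)
  have hγ₀ : Tendsto γ F (𝓝 γ₀) := hγ₀
  have hev : ∀ᶠ i in (F : Filter ι), IsTransportPlan (μ i) (ν i) (γ i) ∧
        planCost (γ i : Measure (UnitSphere d × UnitSphere d)) < b i :=
    h.filter_mono hF |>.mono fun i hi => hγ i hi
  have marg : ∀ (p : UnitSphere d × UnitSphere d → UnitSphere d) (hp : Continuous p)
      (m : ι → SphereProb d) (m₀ : SphereProb d), Tendsto m F (𝓝 m₀) →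
      (∀ᶠ i in (F : Filter ι), (γ i : Measure (UnitSphere d × UnitSphere d)).map p = m i) →
      (γ₀ : Measure (UnitSphere d × UnitSphere d)).map p = m₀ := by
    intro p hp m m₀ hm hmi
    have h1 := ProbabilityMeasure.tendsto_map_of_tendsto_of_continuous γ γ₀ hγ₀ hp
    have h2 : Tendsto m F (𝓝 (γ₀.map hp.measurable.aemeasurable)) := by
      refine h1.congr' (hmi.mono fun i hi => ?_)
      apply Subtype.ext
      simpa using hi
    have := tendsto_nhds_unique h2 hm
    rw [← this]
    simp
  refine ⟨γ₀, ⟨marg _ continuous_fst μ μ₀ (hμ.mono_left hF) (hev.mono fun i hi => hi.1.1),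
    marg _ continuous_snd ν ν₀ (hν.mono_left hF) (hev.mono fun i hi => hi.1.2)⟩, ?_⟩
  have hcost := ProbabilityMeasure.tendsto_iff_forall_lintegral_tendsto.1 hγ₀
    (BoundedContinuousFunction.mkOfCompact
      ⟨fun z => Real.toNNReal (geodesicDist z.1 z.2 ^ 2),
        continuous_real_toNNReal.comp (continuous_geodesicDist.pow 2)⟩)
  exact le_of_tendsto_of_tendsto hcost (hb.mono_left hF) (hev.mono fun i hi => hi.2.le)

theorem exists_optimal_plan (μ ν : SphereProb d) :
    ∃ γ : Measure (UnitSphere d × UnitSphere d), IsTransportPlan μ ν γ ∧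
      planCost γ = wassersteinSq μ ν := by
  obtain ⟨γ, hγ, hc⟩ := exists_plan_of_tendsto (l := atTop) (μ := fun _ : ℕ => μ)
    (ν := fun _ => ν) (μ₀ := μ) (ν₀ := ν) tendsto_const_nhds tendsto_const_nhds
    (b := fun n => wassersteinSq μ ν + ((n : ℝ≥0∞) )⁻¹) (b₀ := wassersteinSq μ ν)
    (by simpa using (tendsto_const_nhds (x := wassersteinSq μ ν)).add
          ENNReal.tendsto_inv_nat_nhds_zero)
    (Eventually.of_forall fun n => ENNReal.lt_add_right (wassersteinSq_lt_top μ ν).ne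
      (by simp))
  exact ⟨γ, hγ, le_antisymm hc (wassersteinSq_le_planCost hγ)⟩

theorem W2_nonneg (μ ν : SphereProb d) : 0 ≤ W2 μ ν := Real.sqrt_nonneg _

theorem W2_sq (μ ν : SphereProb d) : W2 μ ν ^ 2 = (wassersteinSq μ ν).toReal :=
  Real.sq_sqrt ENNReal.toReal_nonneg

theorem ofReal_W2_sq (μ ν : SphereProb d) : ENNReal.ofReal (W2 μ ν ^ 2) = wassersteinSq μ ν := by
  rw [W2_sq, ENNReal.ofReal_toReal (wassersteinSq_lt_top μ ν).ne]

theorem W2_self (μ : SphereProb d) : W2 μ μ = 0 := by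
  have h : wassersteinSq μ μ = 0 := by
    refine le_antisymm ((wassersteinSq_le_planCost
      (γ := (μ : Measure (UnitSphere d)).map (fun x => (x, x))) ⟨?_, ?_⟩).trans ?_) (zero_le)
    · rw [Measure.map_map measurable_fst (by fun_prop)]
      exact Measure.map_id
    · rw [Measure.map_map measurable_snd (by fun_prop)]
      exact Measure.map_id
    · rw [planCost, lintegral_map measurable_planCost_integrand (by fun_prop)]
      simp [geodesicDist_self]
  simp [W2, h]

theorem W2_comm (μ ν : SphereProb d) : W2 μ ν = W2 ν μ := by
  have key : ∀ μ ν : SphereProb d, wassersteinSq μ ν ≤ wassersteinSq ν μ := by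
    intro μ ν
    obtain ⟨γ, hγ, hc⟩ := exists_optimal_plan ν μ
    rw [← hc]
    refine (wassersteinSq_le_planCost (γ := γ.map Prod.swap) ⟨?_, ?_⟩).trans ?_
    · rw [Measure.map_map measurable_fst measurable_swap]
      exact hγ.2
    · rw [Measure.map_map measurable_snd measurable_swap]
      exact hγ.1
    · rw [planCost, lintegral_map measurable_planCost_integrand measurable_swap]
      simp only [Prod.fst_swap, Prod.snd_swap, planCost]
      exact le_of_eq (lintegral_congr fun z => by rw [geodesicDist_comm])
  rw [W2, W2, le_antisymm (key μ ν) (key ν μ)]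

theorem eq_of_W2_eq_zero {μ ν : SphereProb d} (h : W2 μ ν = 0) : μ = ν := by
  obtain ⟨γ, hγ, hc⟩ := exists_optimal_plan μ ν
  rw [← ofReal_W2_sq, h] at hc
  have h0 : planCost γ = 0 := by simpa using hc
  rw [planCost, lintegral_eq_zero_iff measurable_planCost_integrand] at h0
  have h1 : (Prod.fst : UnitSphere d × UnitSphere d → UnitSphere d) =ᵐ[γ] Prod.snd := by
    filter_upwards [h0] with z hz
    have : geodesicDist z.1 z.2 ^ 2 ≤ 0 := by simpa using hz
    exact eq_of_geodesicDist_eq_zero (pow_eq_zero_iff two_ne_zero |>.1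
      (le_antisymm this (sq_nonneg _)))
  exact Subtype.ext (hγ.1.symm.trans ((Measure.map_congr h1).trans hγ.2))

/-- Gluing of two measures along a common marginal, by disintegration of the second one. -/
theorem exists_gluing {X Y Z : Type*} [MeasurableSpace X] [MeasurableSpace Y] [MeasurableSpace Z]
    [StandardBorelSpace Z] [Nonempty Z] (γ₁ : Measure (X × Y)) (γ₂ : Measure (Y × Z))
    [IsFiniteMeasure γ₁] [IsFiniteMeasure γ₂] (h : γ₁.snd = γ₂.fst) :
    ∃ γ : Measure ((X × Y) × Z), γ.map Prod.fst = γ₁ ∧ γ.map (fun z => (z.1.2, z.2)) = γ₂ := by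
  refine ⟨γ₁.compProd (γ₂.condKernel.comap Prod.snd measurable_snd), Measure.fst_compProd _ _, ?_⟩
  ext s hs
  have hm : Measurable (fun z : (X × Y) × Z => (z.1.2, z.2)) := by fun_prop
  rw [Measure.map_apply hm hs, Measure.compProd_apply (hm hs)]
  conv_rhs => rw [← γ₂.disintegrate γ₂.condKernel, Measure.compProd_apply hs, ← h, Measure.snd]
  rw [lintegral_map (ProbabilityTheory.Kernel.measurable_kernel_prodMk_left hs) measurable_snd]
  rfl

/-- `W₂` is the `L²` norm of the distance under an optimal plan. -/
theorem ofReal_W2_eq_rpow {μ ν : SphereProb d} {γ : Measure (UnitSphere d × UnitSphere d)}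
    (hγ : planCost γ = wassersteinSq μ ν) :
    ENNReal.ofReal (W2 μ ν) =
      (∫⁻ z, ENNReal.ofReal (geodesicDist z.1 z.2) ^ (2 : ℝ) ∂γ) ^ (1 / 2 : ℝ) := by
  have h1 : ∫⁻ z, ENNReal.ofReal (geodesicDist z.1 z.2) ^ (2 : ℝ) ∂γ = planCost γ :=
    lintegral_congr fun z => by
      rw [ENNReal.rpow_ofNat, ENNReal.ofReal_pow (geodesicDist_nonneg _ _)]
  rw [h1, hγ, ← ofReal_W2_sq, ENNReal.ofReal_rpow_of_nonneg (sq_nonneg _) (by norm_num),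
    ← Real.sqrt_eq_rpow, Real.sqrt_sq (W2_nonneg _ _)]

theorem W2_triangle (μ ν ρ : SphereProb d) : W2 μ ρ ≤ W2 μ ν + W2 ν ρ := by
  have : Nonempty (UnitSphere d) := μ.nonempty
  obtain ⟨γ₁, hγ₁, hc₁⟩ := exists_optimal_plan μ ν
  obtain ⟨γ₂, hγ₂, hc₂⟩ := exists_optimal_plan ν ρ
  have hp₁ : IsProbabilityMeasure γ₁ := by
    have h1 : IsProbabilityMeasure (γ₁.map Prod.fst) := by rw [hγ₁.1]; infer_instance
    exact Measure.isProbabilityMeasure_of_map Prod.fst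
  have hp₂ : IsProbabilityMeasure γ₂ := by
    have h1 : IsProbabilityMeasure (γ₂.map Prod.fst) := by rw [hγ₂.1]; infer_instance
    exact Measure.isProbabilityMeasure_of_map Prod.fst
  -- the outer marginal of the glued plan is admissible, and Minkowski's inequality bounds its cost
  obtain ⟨γ, hg₁, hg₂⟩ := exists_gluing γ₁ γ₂ (hγ₁.2.trans hγ₂.1.symm)
  have hm₁ : Measurable (fun z : (UnitSphere d × UnitSphere d) × UnitSphere d => z.1) :=
    measurable_fst
  have hm₂ : Measurable
      (fun z : (UnitSphere d × UnitSphere d) × UnitSphere d => (z.1.2, z.2)) := by fun_prop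
  have hm₃ : Measurable
      (fun z : (UnitSphere d × UnitSphere d) × UnitSphere d => (z.1.1, z.2)) := by fun_prop
  have hplan : IsTransportPlan μ ρ (γ.map (fun z => (z.1.1, z.2))) := by
    constructor
    · rw [Measure.map_map measurable_fst hm₃, ← hγ₁.1, ← hg₁,
        Measure.map_map measurable_fst measurable_fst]
      rfl
    · rw [Measure.map_map measurable_snd hm₃, ← hγ₂.2, ← hg₂,
        Measure.map_map measurable_snd hm₂]
      rfl
  have hdm : Measurable (fun z : UnitSphere d × UnitSphere d =>
      ENNReal.ofReal (geodesicDist z.1 z.2)) :=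
    (ENNReal.continuous_ofReal.comp continuous_geodesicDist).measurable
  have key : ENNReal.ofReal (W2 μ ρ) ≤ ENNReal.ofReal (W2 μ ν) + ENNReal.ofReal (W2 ν ρ) := by
    rw [ofReal_W2_eq_rpow hc₁, ofReal_W2_eq_rpow hc₂, ← hg₁, ← hg₂,
      lintegral_map (hdm.pow_const _) hm₁, lintegral_map (hdm.pow_const _) hm₂]
    refine le_trans ?_ (ENNReal.lintegral_Lp_add_le (hdm.comp hm₁).aemeasurable
      (hdm.comp hm₂).aemeasurable (by norm_num : (1 : ℝ) ≤ 2))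
    have h1 : ENNReal.ofReal (W2 μ ρ) = (wassersteinSq μ ρ) ^ (1 / 2 : ℝ) := by
      rw [← ofReal_W2_sq, ENNReal.ofReal_rpow_of_nonneg (sq_nonneg _) (by norm_num),
        ← Real.sqrt_eq_rpow, Real.sqrt_sq (W2_nonneg _ _)]
    rw [h1]
    refine ENNReal.rpow_le_rpow ((wassersteinSq_le_planCost hplan).trans ?_) (by norm_num)
    rw [planCost, lintegral_map measurable_planCost_integrand hm₃]
    refine lintegral_mono fun z => ?_
    simp only [Pi.add_apply]
    rw [ENNReal.rpow_ofNat, ← ENNReal.ofReal_add (geodesicDist_nonneg _ _)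
      (geodesicDist_nonneg _ _), ← ENNReal.ofReal_pow
      (add_nonneg (geodesicDist_nonneg _ _) (geodesicDist_nonneg _ _))]
    exact ENNReal.ofReal_le_ofReal
      (pow_le_pow_left₀ (geodesicDist_nonneg _ _) (geodesicDist_triangle _ _ _) 2)
  rw [← ENNReal.ofReal_add (W2_nonneg _ _) (W2_nonneg _ _)] at key
  exact (ENNReal.ofReal_le_ofReal_iff (add_nonneg (W2_nonneg _ _) (W2_nonneg _ _))).1 key

/-- The Wasserstein distance is lower semicontinuous under narrow convergence. -/
theorem W2_le_of_tendsto {ι : Type*} {l : Filter ι} [l.NeBot] {μ ν : ι → SphereProb d}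
    {μ₀ ν₀ : SphereProb d} (hμ : Tendsto μ l (𝓝 μ₀)) (hν : Tendsto ν l (𝓝 ν₀))
    {b : ι → ℝ} {b₀ : ℝ} (hb : Tendsto b l (𝓝 b₀))
    (h : ∀ᶠ i in l, W2 (μ i) (ν i) ≤ b i) : W2 μ₀ ν₀ ≤ b₀ := by
  have hb₀ : 0 ≤ b₀ := ge_of_tendsto hb (h.mono fun i hi => (W2_nonneg _ _).trans hi)
  refine le_of_forall_pos_le_add fun ε hε => ?_
  obtain ⟨γ, hγ, hc⟩ := exists_plan_of_tendsto hμ hν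
    (b := fun i => ENNReal.ofReal ((b i + ε) ^ 2)) (b₀ := ENNReal.ofReal ((b₀ + ε) ^ 2))
    ((ENNReal.continuous_ofReal.tendsto _).comp ((hb.add_const ε).pow 2))
    (h.mono fun i hi => by
      have h0 := W2_nonneg (μ i) (ν i)
      rw [← ofReal_W2_sq]
      exact (ENNReal.ofReal_lt_ofReal_iff (pow_pos (by linarith) 2)).2
        (pow_lt_pow_left₀ (by linarith) h0 two_ne_zero))
  have h1 := (wassersteinSq_le_planCost hγ).trans hc
  rw [← ofReal_W2_sq, ENNReal.ofReal_le_ofReal_iff (sq_nonneg _)] at h1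
  exact (pow_le_pow_iff_left₀ (W2_nonneg _ _) (by positivity) two_ne_zero).1 h1

end Wasserstein

/-! ### Second differences and the generator -/

section Calculus

/-- A one-sided bound on symmetric second differences along a line bounds the second derivative:
otherwise `s ↦ ψ(θ+sh) + ψ(θ-sh) - 2ψ(θ) - L s²` would have both a local maximum and, by the second
derivative test, a local minimum at `0`, hence be locally constant. -/
theorem fderiv_fderiv_le_of_second_difference_le {E : Type*} [NormedAddCommGroup E]
    [NormedSpace ℝ E] {ψ : E → ℝ} (hψ : ContDiff ℝ 2 ψ) (θ h : E) {L : ℝ}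
    (hL : ∀ s : ℝ, ψ (θ + s • h) + ψ (θ - s • h) - 2 * ψ θ ≤ L * s ^ 2) :
    fderiv ℝ (fderiv ℝ ψ) θ h h ≤ L := by
  set p : ℝ → ℝ := fun s => ψ (θ + s • h) + ψ (θ - s • h) - 2 * ψ θ - L * s ^ 2 with hp
  have hd : Differentiable ℝ ψ := hψ.differentiable two_ne_zero
  have hd2 : Differentiable ℝ (fderiv ℝ ψ) :=
    (hψ.fderiv_right (m := 1) le_rfl).differentiable one_ne_zero
  have hl : ∀ s : ℝ, HasDerivAt (fun s : ℝ => θ + s • h) h s := fun s => by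
    simpa using ((hasDerivAt_id s).smul_const h).const_add θ
  have hl' : ∀ s : ℝ, HasDerivAt (fun s : ℝ => θ - s • h) (-h) s := fun s => by
    simpa using ((hasDerivAt_id s).smul_const h).const_sub θ
  have hq : ∀ η, HasFDerivAt (fun η => fderiv ℝ ψ η h) ((fderiv ℝ (fderiv ℝ ψ) η).flip h) η :=
    fun η => (ContinuousLinearMap.apply ℝ ℝ h).hasFDerivAt.comp η (hd2 η).hasFDerivAt
  have h1 : ∀ s, HasDerivAt p
      (fderiv ℝ ψ (θ + s • h) h - fderiv ℝ ψ (θ - s • h) h - L * (2 * s)) s := fun s => by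
    have e1 : HasDerivAt (fun s : ℝ => ψ (θ + s • h)) (fderiv ℝ ψ (θ + s • h) h) s :=
      (hd (θ + s • h)).hasFDerivAt.comp_hasDerivAt s (hl s)
    have e2 : HasDerivAt (fun s : ℝ => ψ (θ - s • h)) (-fderiv ℝ ψ (θ - s • h) h) s := by
      rw [← map_neg]
      exact (hd (θ - s • h)).hasFDerivAt.comp_hasDerivAt s (hl' s)
    have e3 : HasDerivAt (fun s : ℝ => L * s ^ 2) (L * (2 * s)) s := by
      simpa using (hasDerivAt_pow 2 s).const_mul L
    exact ((e1.add e2).sub_const (2 * ψ θ)).sub e3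
  have hdp : deriv p = fun s =>
      fderiv ℝ ψ (θ + s • h) h - fderiv ℝ ψ (θ - s • h) h - L * (2 * s) :=
    funext fun s => (h1 s).deriv
  have h2 : HasDerivAt (deriv p) (2 * fderiv ℝ (fderiv ℝ ψ) θ h h - 2 * L) 0 := by
    rw [hdp]
    have e1 : HasDerivAt (fun s : ℝ => fderiv ℝ ψ (θ + s • h) h)
        (fderiv ℝ (fderiv ℝ ψ) (θ + (0 : ℝ) • h) h h) 0 := by
      have := (hq (θ + (0 : ℝ) • h)).comp_hasDerivAt (0 : ℝ) (hl 0)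
      exact this
    have e2 : HasDerivAt (fun s : ℝ => fderiv ℝ ψ (θ - s • h) h)
        (-fderiv ℝ (fderiv ℝ ψ) (θ - (0 : ℝ) • h) h h) 0 := by
      have := (hq (θ - (0 : ℝ) • h)).comp_hasDerivAt (0 : ℝ) (hl' 0)
      rwa [map_neg] at this
    have e3 : HasDerivAt (fun s : ℝ => L * (2 * s)) (L * (2 * 1)) 0 :=
      ((hasDerivAt_id (0 : ℝ)).const_mul 2).const_mul L
    rw [zero_smul, add_zero] at e1
    rw [zero_smul, sub_zero] at e2
    have e4 := (e1.sub e2).sub e3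
    have e5 : fderiv ℝ (fderiv ℝ ψ) θ h h - -fderiv ℝ (fderiv ℝ ψ) θ h h - L * (2 * 1) =
        2 * fderiv ℝ (fderiv ℝ ψ) θ h h - 2 * L := by ring
    rw [e5] at e4
    exact e4
  by_contra hlt
  push Not at hlt
  have hmin : IsLocalMin p 0 := by
    refine isLocalMin_of_deriv_deriv_pos ?_ ?_ (h1 0).continuousAt
    · rw [h2.deriv]
      linarith
    · rw [hdp]
      simp
  have hp0 : p 0 = 0 := by simp [hp]; ring
  have hz : p =ᶠ[𝓝 0] fun _ => 0 := by
    filter_upwards [hmin] with s hs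
    rw [hp0] at hs
    have := hL s
    exact le_antisymm (by simp only [hp]; linarith) hs
  have h3 : deriv (deriv p) 0 = 0 := by
    have e : deriv p =ᶠ[𝓝 0] deriv (fun _ : ℝ => (0 : ℝ)) := hz.deriv
    rw [e.deriv_eq]
    simp
  rw [h2.deriv] at h3
  linarith

theorem abs_fderiv_fderiv_le_of_second_difference {E : Type*} [NormedAddCommGroup E]
    [NormedSpace ℝ E] {ψ : E → ℝ} (hψ : ContDiff ℝ 2 ψ) {L : ℝ}
    (hL : ∀ θ h, |ψ (θ + h) + ψ (θ - h) - 2 * ψ θ| ≤ L * ‖h‖ ^ 2) (θ h : E) :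
    |fderiv ℝ (fderiv ℝ ψ) θ h h| ≤ L * ‖h‖ ^ 2 := by
  have hs : ∀ s : ℝ, |ψ (θ + s • h) + ψ (θ - s • h) - 2 * ψ θ| ≤ (L * ‖h‖ ^ 2) * s ^ 2 := by
    intro s
    have := hL θ (s • h)
    rw [norm_smul, mul_pow, Real.norm_eq_abs, sq_abs] at this
    linarith
  rw [abs_le]
  constructor
  · have h1 := fderiv_fderiv_le_of_second_difference_le (ψ := -ψ) hψ.neg θ h (L := L * ‖h‖ ^ 2)
      (fun s => by
        have := (abs_le.1 (hs s)).1
        simp only [Pi.neg_apply]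
        linarith)
    have h2 : fderiv ℝ (-ψ) = -fderiv ℝ ψ := by
      ext x
      simp [fderiv_neg]
    rw [h2, fderiv_neg] at h1
    simp only [neg_apply] at h1
    linarith
  · exact fderiv_fderiv_le_of_second_difference_le hψ θ h fun s => (abs_le.1 (hs s)).2

end Calculus

section Generator

variable {α ξ : ℕ}

/-- The spatial part `⟨∇ψ, f⟩ + ∇²ψ : G` of the Kolmogorov operator. -/
noncomputable def generator
    (f : EuclideanSpace ℝ (Fin α) → ℝ → EuclideanSpace ℝ (Fin α))
    (g : EuclideanSpace ℝ (Fin α) → ℝ → Matrix (Fin α) (Fin ξ) ℝ)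
    (ψ : EuclideanSpace ℝ (Fin α) → ℝ) (θ : EuclideanSpace ℝ (Fin α)) (t : ℝ) : ℝ :=
  fderiv ℝ ψ θ (f θ t)
    + ∑ i, ∑ j, fderiv ℝ (fderiv ℝ ψ) θ (EuclideanSpace.single i 1) (EuclideanSpace.single j 1)
        * diffusionMatrix g θ t i j

variable {f : EuclideanSpace ℝ (Fin α) → ℝ → EuclideanSpace ℝ (Fin α)}
  {g : EuclideanSpace ℝ (Fin α) → ℝ → Matrix (Fin α) (Fin ξ) ℝ}

theorem kolmogorovOperator_mul {ψ : EuclideanSpace ℝ (Fin α) → ℝ} {χ : ℝ → ℝ}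
    (hψ : ContDiff ℝ ∞ ψ) (θ : EuclideanSpace ℝ (Fin α)) (t : ℝ) :
    kolmogorovOperator f g (fun z => ψ z.1 * χ z.2) θ t =
      ψ θ * deriv χ t + χ t * generator f g ψ θ t := by
  have hd : Differentiable ℝ ψ := hψ.differentiable (by simp)
  have hd2 : Differentiable ℝ (fderiv ℝ ψ) :=
    (hψ.fderiv_right (m := ∞) (by simp)).differentiable (by simp)
  have h1 : ∀ η, fderiv ℝ (fun ζ => ψ ζ * χ t) η = χ t • fderiv ℝ ψ η := fun η =>
    fderiv_mul_const (hd η) (χ t)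
  have h2 : fderiv ℝ (fun η => fderiv ℝ (fun ζ => ψ ζ * χ t) η) θ
      = χ t • fderiv ℝ (fderiv ℝ ψ) θ := by
    simp_rw [h1]
    exact fderiv_const_smul (hd2 θ) (χ t)
  have h3 : deriv (fun s => ψ θ * χ s) t = ψ θ * deriv χ t := deriv_const_mul_field (ψ θ)
  simp only [kolmogorovOperator, generator]
  rw [h3, h1, h2]
  simp only [smul_apply, smul_eq_mul, mul_add, Finset.mul_sum, add_assoc,
    mul_assoc]

/-- `B : G = ½ ∑ₖ B(gₖ, gₖ)`, where `gₖ` are the columns of `g`. -/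
theorem sum_mul_diffusionMatrix
    (B : EuclideanSpace ℝ (Fin α) →L[ℝ] EuclideanSpace ℝ (Fin α) →L[ℝ] ℝ)
    (θ : EuclideanSpace ℝ (Fin α)) (t : ℝ) :
    ∑ i, ∑ j, B (EuclideanSpace.single i 1) (EuclideanSpace.single j 1)
        * diffusionMatrix g θ t i j =
      (1 / 2) * ∑ k, B (WithLp.toLp 2 fun i => g θ t i k) (WithLp.toLp 2 fun i => g θ t i k) := by
  have hv : ∀ k, (WithLp.toLp 2 fun i => g θ t i k : EuclideanSpace ℝ (Fin α)) =
      ∑ i, g θ t i k • EuclideanSpace.single i (1 : ℝ) := by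
    intro k
    ext j
    simp [Finset.sum_apply, Pi.single_apply]
  have hB : ∀ k, B (WithLp.toLp 2 fun i => g θ t i k) (WithLp.toLp 2 fun i => g θ t i k) =
      ∑ i, ∑ j, g θ t i k * g θ t j k *
        B (EuclideanSpace.single i 1) (EuclideanSpace.single j 1) := by
    intro k
    rw [hv k, map_sum, Finset.sum_comm]
    refine Finset.sum_congr rfl fun j _ => ?_
    rw [map_sum, sum_apply]
    refine Finset.sum_congr rfl fun i _ => ?_
    simp only [map_smul, smul_apply, smul_eq_mul]
    ring
  have hG : ∀ i j, diffusionMatrix g θ t i j = (1 / 2) * ∑ k, g θ t i k * g θ t j k := by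
    intro i j
    simp [diffusionMatrix, Matrix.mul_apply]
  simp_rw [hB, hG]
  rw [Finset.sum_comm (s := (Finset.univ : Finset (Fin ξ))), Finset.mul_sum]
  refine Finset.sum_congr rfl fun i _ => ?_
  rw [Finset.sum_comm (s := (Finset.univ : Finset (Fin ξ))), Finset.mul_sum]
  refine Finset.sum_congr rfl fun j _ => ?_
  rw [← Finset.sum_mul]
  ring

theorem abs_generator_le {ψ : EuclideanSpace ℝ (Fin α) → ℝ} (hψ : ContDiff ℝ ∞ ψ) {L : ℝ}
    (hL1 : ∀ θ, ‖fderiv ℝ ψ θ‖ ≤ L)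
    (hL2 : ∀ θ h, |ψ (θ + h) + ψ (θ - h) - 2 * ψ θ| ≤ L * ‖h‖ ^ 2)
    (θ : EuclideanSpace ℝ (Fin α)) (t : ℝ) :
    |generator f g ψ θ t| ≤ L * (‖f θ t‖ + ∑ k, ∑ i, g θ t i k ^ 2) := by
  have hL : 0 ≤ L := (norm_nonneg _).trans (hL1 θ)
  have h1 : |fderiv ℝ ψ θ (f θ t)| ≤ L * ‖f θ t‖ :=
    (ContinuousLinearMap.le_opNorm _ _).trans
      (mul_le_mul_of_nonneg_right (hL1 θ) (norm_nonneg _))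
  have h2 : ∀ k, |fderiv ℝ (fderiv ℝ ψ) θ (WithLp.toLp 2 fun i => g θ t i k)
      (WithLp.toLp 2 fun i => g θ t i k)| ≤ L * ∑ i, g θ t i k ^ 2 := by
    intro k
    have := abs_fderiv_fderiv_le_of_second_difference (contDiff_infty.1 hψ 2) hL2 θ
      (WithLp.toLp 2 fun i => g θ t i k)
    rwa [EuclideanSpace.real_norm_sq_eq] at this
  rw [generator, sum_mul_diffusionMatrix, mul_add, Finset.mul_sum (Finset.univ (α := Fin ξ)) (fun k => ∑ i, g θ t i k ^ 2) L]
  refine (abs_add_le _ _).trans (add_le_add h1 ?_)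
  rw [abs_mul]
  calc |(1 / 2 : ℝ)| * |∑ k, fderiv ℝ (fderiv ℝ ψ) θ (WithLp.toLp 2 fun i => g θ t i k)
        (WithLp.toLp 2 fun i => g θ t i k)|
      ≤ 1 * |∑ k, fderiv ℝ (fderiv ℝ ψ) θ (WithLp.toLp 2 fun i => g θ t i k)
        (WithLp.toLp 2 fun i => g θ t i k)| :=
        mul_le_mul_of_nonneg_right (by rw [abs_of_pos] <;> norm_num) (abs_nonneg _)
    _ ≤ ∑ k, L * ∑ i, g θ t i k ^ 2 := by
        rw [one_mul]
        exact (Finset.abs_sum_le_sum_abs _ _).trans (Finset.sum_le_sum fun k _ => h2 k)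

theorem generator_eq_zero {ψ : EuclideanSpace ℝ (Fin α) → ℝ}
    {θ : EuclideanSpace ℝ (Fin α)} (h : θ ∉ tsupport ψ) (t : ℝ) : generator f g ψ θ t = 0 := by
  have h1 : fderiv ℝ ψ θ = 0 := by
    by_contra h'
    exact h (support_fderiv_subset ℝ h')
  have h2 : fderiv ℝ (fderiv ℝ ψ) θ = 0 := by
    by_contra h'
    exact h (tsupport_fderiv_subset ℝ (support_fderiv_subset ℝ h'))
  simp [generator, h1, h2]

theorem measurable_generator
    (hf : Measurable (Function.uncurry f))
    (hg : ∀ i j, Measurable (fun z : EuclideanSpace ℝ (Fin α) × ℝ => g z.1 z.2 i j))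
    {ψ : EuclideanSpace ℝ (Fin α) → ℝ} (hψ : ContDiff ℝ ∞ ψ) :
    Measurable (fun z : EuclideanSpace ℝ (Fin α) × ℝ => generator f g ψ z.1 z.2) := by
  have c1 : Continuous (fderiv ℝ ψ) := hψ.continuous_fderiv (by simp)
  have c2 : Continuous (fderiv ℝ (fderiv ℝ ψ)) :=
    (hψ.fderiv_right (m := ∞) (by simp)).continuous_fderiv (by simp)
  unfold generator
  refine Measurable.add ?_ (Finset.measurable_sum _ fun i _ => Finset.measurable_sum _ fun j _ => ?_)
  · have e : Continuous (fun p : (EuclideanSpace ℝ (Fin α) →L[ℝ] ℝ) × EuclideanSpace ℝ (Fin α) =>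
        p.1 p.2) := isBoundedBilinearMap_apply.continuous
    exact e.measurable.comp ((c1.measurable.comp measurable_fst).prodMk hf)
  · refine Measurable.mul ?_ ?_
    · have : Continuous (fun θ => fderiv ℝ (fderiv ℝ ψ) θ (EuclideanSpace.single i 1)
          (EuclideanSpace.single j (1 : ℝ))) := by fun_prop
      exact this.measurable.comp measurable_fst
    · have hG : ∀ z : EuclideanSpace ℝ (Fin α) × ℝ, diffusionMatrix g z.1 z.2 i j =
          (1 / 2) * ∑ k, g z.1 z.2 i k * g z.1 z.2 j k := by
        intro z
        simp [diffusionMatrix, Matrix.mul_apply]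
      simp_rw [hG]
      exact (Finset.measurable_sum _ fun k _ => (hg i k).mul (hg j k)).const_mul _

end Generator

/-! ### Weak solutions in time -/

section TimeCutoff

/-- `x ↦ ∫₀ˣ (ρ(s-y) - ρ(t-y)) dy` for the normalized bump function `ρ` of `φ`, a smooth approximation of the indicator of `[s, t]` whose
derivative tests the values near `s` against those near `t`. -/
noncomputable def timeCutoff (φ : ContDiffBump (0 : ℝ)) (s t x : ℝ) : ℝ :=
  ∫ y in (0 : ℝ)..x, (φ.normed volume (s - y) - φ.normed volume (t - y))

variable (φ : ContDiffBump (0 : ℝ))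

theorem deriv_timeCutoff (s t : ℝ) :
    deriv (timeCutoff φ s t) = fun x => φ.normed volume (s - x) - φ.normed volume (t - x) := by
  have hc : Continuous (φ.normed volume) := φ.continuous_normed
  exact funext fun x => Continuous.deriv_integral _ (by fun_prop) 0 x

theorem contDiff_timeCutoff (s t : ℝ) : ContDiff ℝ ∞ (timeCutoff φ s t) := by
  have hc : Continuous (φ.normed volume) := φ.continuous_normed
  have hc' : ContDiff ℝ ∞ (φ.normed volume) := φ.contDiff_normed
  rw [contDiff_infty_iff_deriv, deriv_timeCutoff]
  refine ⟨fun x => ?_, ?_⟩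
  · exact (Continuous.integral_hasStrictDerivAt (f := fun y =>
      φ.normed volume (s - y) - φ.normed volume (t - y)) (by fun_prop)
      0 x).hasDerivAt.differentiableAt
  · exact (hc'.comp (contDiff_const.sub contDiff_id)).sub
      (hc'.comp (contDiff_const.sub contDiff_id))

theorem normed_eq_zero_of_le {z : ℝ} (h : φ.rOut ≤ |z|) : φ.normed volume z = 0 := by
  have : z ∉ Function.support (φ.normed volume) := by
    rw [φ.support_normed_eq]
    simpa using h
  simpa using this

theorem integral_normed_shift_eq_zero {s x : ℝ} (h0 : φ.rOut ≤ s) (hx : x ≤ s - φ.rOut) :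
    ∫ y in (0 : ℝ)..x, φ.normed volume (s - y) = 0 := by
  have : ∫ y in (0 : ℝ)..x, φ.normed volume (s - y) = ∫ _ in (0 : ℝ)..x, (0 : ℝ) := by
    refine intervalIntegral.integral_congr fun y hy => ?_
    have h1 : y ≤ s - φ.rOut := hy.2.trans (max_le (by linarith) hx)
    exact normed_eq_zero_of_le φ (by rw [abs_of_nonneg] <;> linarith [φ.rOut_pos])
  simpa using this

theorem integral_normed_shift_eq_one {s x : ℝ} (h0 : φ.rOut < s) (hx : s + φ.rOut ≤ x) :
    ∫ y in (0 : ℝ)..x, φ.normed volume (s - y) = 1 := by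
  rw [intervalIntegral.integral_eq_integral_of_support_subset]
  · rw [integral_sub_left_eq_self (fun z => φ.normed volume z) volume s]
    exact φ.integral_normed
  · intro y hy
    have h1 : |s - y| < φ.rOut := by
      by_contra hlt
      exact hy (normed_eq_zero_of_le φ (not_lt.1 hlt))
    rw [abs_lt] at h1
    exact ⟨by linarith, by linarith⟩

theorem integral_normed_shift_mem {s x : ℝ} (h0 : φ.rOut < s) :
    ∫ y in (0 : ℝ)..x, φ.normed volume (s - y) ∈ Icc (0 : ℝ) 1 := by
  have hc : Continuous (φ.normed volume) := φ.continuous_normed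
  have hi : ∀ a b, IntervalIntegrable (fun y => φ.normed volume (s - y)) volume a b :=
    fun a b => Continuous.intervalIntegrable (by fun_prop) a b
  rcases le_total x (s - φ.rOut) with h | h
  · rw [integral_normed_shift_eq_zero φ h0.le h]
    simp
  · have hx : 0 ≤ x := by linarith
    refine ⟨intervalIntegral.integral_nonneg hx fun y _ => φ.nonneg_normed _, ?_⟩
    have h1 := integral_normed_shift_eq_one φ h0 (le_max_right x (s + φ.rOut))
    rw [← intervalIntegral.integral_add_adjacent_intervals (hi 0 x) (hi x _)] at h1
    linarith [intervalIntegral.integral_nonneg (μ := volume) (f := fun y => φ.normed volume (s - y))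
      (le_max_left x (s + φ.rOut)) fun y _ => φ.nonneg_normed _]

theorem timeCutoff_eq_sub (s t x : ℝ) : timeCutoff φ s t x =
    (∫ y in (0 : ℝ)..x, φ.normed volume (s - y)) - ∫ y in (0 : ℝ)..x, φ.normed volume (t - y) := by
  have hc : Continuous (φ.normed volume) := φ.continuous_normed
  exact intervalIntegral.integral_sub (Continuous.intervalIntegrable (by fun_prop) _ _)
    (Continuous.intervalIntegrable (by fun_prop) _ _)

variable {φ} in
theorem timeCutoff_mem {s t : ℝ} (h0 : φ.rOut < s) (hst : s + φ.rOut ≤ t - φ.rOut) (x : ℝ) :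
    timeCutoff φ s t x ∈ Icc (0 : ℝ) 1 := by
  have h0t : φ.rOut < t := by linarith [φ.rOut_pos]
  rw [timeCutoff_eq_sub]
  rcases le_total x (t - φ.rOut) with h | h
  · rw [integral_normed_shift_eq_zero φ h0t.le h, sub_zero]
    exact integral_normed_shift_mem φ h0
  · rw [integral_normed_shift_eq_one φ h0 (hst.trans h)]
    have := integral_normed_shift_mem φ (x := x) h0t
    exact ⟨by linarith [this.2], by linarith [this.1]⟩

variable {φ} in
theorem timeCutoff_eq_zero {s t : ℝ} (h0 : φ.rOut < s) (hst : s + φ.rOut ≤ t - φ.rOut) {x : ℝ}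
    (hx : x ∉ Icc (s - φ.rOut) (t + φ.rOut)) : timeCutoff φ s t x = 0 := by
  have h0t : φ.rOut < t := by linarith [φ.rOut_pos]
  rw [timeCutoff_eq_sub]
  rcases lt_or_ge x (s - φ.rOut) with h | h
  · rw [integral_normed_shift_eq_zero φ h0.le h.le,
      integral_normed_shift_eq_zero φ h0t.le (by linarith [φ.rOut_pos]), sub_zero]
  · have h' : t + φ.rOut ≤ x := by
      by_contra hlt
      exact hx ⟨h, (not_le.1 hlt).le⟩
    rw [integral_normed_shift_eq_one φ h0 (by linarith), integral_normed_shift_eq_one φ h0t h',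
      sub_self]

variable {φ} in
theorem tsupport_timeCutoff {s t : ℝ} (h0 : φ.rOut < s) (hst : s + φ.rOut ≤ t - φ.rOut) :
    tsupport (timeCutoff φ s t) ⊆ Icc (s - φ.rOut) (t + φ.rOut) := by
  refine closure_minimal (fun x hx => ?_) isClosed_Icc
  by_contra h
  exact hx (timeCutoff_eq_zero h0 hst h)

end TimeCutoff

section WeakDerivative

variable {T : ℝ} {F H c : ℝ → ℝ}

/-- Testing with `timeCutoff` compares the mollifications of `F` at the times `s` and `t`. -/
theorem abs_convolution_sub_le (hF : Continuous F)
    (hH : AEStronglyMeasurable H (volume.restrict (Ioo 0 T)))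
    (hc : IntegrableOn c (Icc 0 T)) (hHc : ∀ᵐ t ∂(volume.restrict (Icc 0 T)), |H t| ≤ c t)
    (hweak : ∀ χ : ℝ → ℝ, ContDiff ℝ ∞ χ → HasCompactSupport χ → tsupport χ ⊆ Ioo 0 T →
      ∫ t in Ioo 0 T, (F t * deriv χ t + χ t * H t) = 0)
    {φ : ContDiffBump (0 : ℝ)} {s t : ℝ} (h0 : φ.rOut < s) (hst : s + φ.rOut ≤ t - φ.rOut)
    (hT : t + φ.rOut < T) :
    |(convolution (φ.normed volume) F (ContinuousLinearMap.lsmul ℝ ℝ) volume) s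
      - (convolution (φ.normed volume) F (ContinuousLinearMap.lsmul ℝ ℝ) volume) t|
      ≤ ∫ x in (s - φ.rOut)..(t + φ.rOut), c x := by
  set χ := timeCutoff φ s t with hχ
  have hφc : Continuous (φ.normed volume) := φ.continuous_normed
  have hsm : ContDiff ℝ ∞ χ := contDiff_timeCutoff φ s t
  have hts := tsupport_timeCutoff h0 hst
  have hsub : Icc (s - φ.rOut) (t + φ.rOut) ⊆ Ioo 0 T := fun x hx =>
    ⟨by linarith [hx.1], by linarith [hx.2]⟩
  have hcs : HasCompactSupport χ := isCompact_Icc.of_isClosed_subset (isClosed_tsupport _) hts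
  have hw := hweak χ hsm hcs (hts.trans hsub)
  have hcont : Continuous (deriv χ) := hsm.continuous_deriv (by simp)
  have hcIoo : IntegrableOn c (Ioo 0 T) := hc.mono_set Ioo_subset_Icc_self
  have hHc' : ∀ᵐ t ∂(volume.restrict (Ioo 0 T)), |H t| ≤ c t :=
    ae_restrict_of_ae_restrict_of_subset Ioo_subset_Icc_self hHc
  have hχH : ∀ᵐ x ∂(volume.restrict (Ioo 0 T)),
      ‖χ x * H x‖ ≤ (Icc (s - φ.rOut) (t + φ.rOut)).indicator c x := by
    filter_upwards [hHc'] with x hx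
    by_cases hm : x ∈ Icc (s - φ.rOut) (t + φ.rOut)
    · rw [indicator_of_mem hm, norm_mul, Real.norm_eq_abs, Real.norm_eq_abs]
      have h1 := timeCutoff_mem h0 hst x
      rw [abs_of_nonneg h1.1]
      exact (mul_le_of_le_one_left (abs_nonneg _) h1.2).trans hx
    · rw [indicator_of_notMem hm, hχ, timeCutoff_eq_zero h0 hst hm]
      simp
  have hind : IntegrableOn ((Icc (s - φ.rOut) (t + φ.rOut)).indicator c) (Ioo 0 T) :=
    Integrable.indicator hcIoo measurableSet_Icc
  have hint2 : IntegrableOn (fun x => χ x * H x) (Ioo 0 T) :=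
    Integrable.mono' hind (hsm.continuous.aestronglyMeasurable.mul hH) hχH
  have hint1 : Integrable (fun x => F x * deriv χ x) :=
    (hF.mul hcont).integrable_of_hasCompactSupport hcs.deriv.mul_left
  rw [integral_add hint1.integrableOn hint2] at hw
  have e1 : ∫ x in Ioo 0 T, F x * deriv χ x = ∫ x, F x * deriv χ x := by
    refine setIntegral_eq_integral_of_forall_compl_eq_zero fun x hx => ?_
    have : deriv χ x = 0 := by
      by_contra h
      exact hx (hsub (hts (support_deriv_subset h)))
    rw [this, mul_zero]
  have hcsφ : HasCompactSupport (φ.normed volume) := φ.hasCompactSupport_normed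
  have hconv : ∀ a : ℝ, Integrable (fun x => φ.normed volume (a - x) * F x) := fun a =>
    Continuous.integrable_of_hasCompactSupport (by fun_prop)
      ((hcsφ.comp_homeomorph (Homeomorph.subLeft a)).mul_right)
  have e2 : ∫ x, F x * deriv χ x =
      (convolution (φ.normed volume) F (ContinuousLinearMap.lsmul ℝ ℝ) volume) s
      - (convolution (φ.normed volume) F (ContinuousLinearMap.lsmul ℝ ℝ) volume) t := by
    rw [convolution_lsmul_swap, convolution_lsmul_swap, hχ, deriv_timeCutoff]
    simp only [smul_eq_mul]
    rw [← integral_sub (hconv s) (hconv t)]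
    exact integral_congr_ae (Eventually.of_forall fun x => by ring)
  rw [← e2, ← e1, eq_neg_of_add_eq_zero_left hw, abs_neg]
  refine (norm_integral_le_of_norm_le hind hχH).trans (le_of_eq ?_)
  rw [setIntegral_indicator measurableSet_Icc, inter_eq_self_of_subset_right hsub,
    integral_Icc_eq_integral_Ioc, intervalIntegral.integral_of_le (by linarith [φ.rOut_pos])]

/-- A continuous function whose weak derivative on `(0, T)` is dominated by `c` has increments
dominated by the integrals of `c`. -/
theorem abs_sub_le_integral_of_weak_deriv (hT : 0 < T) (hF : Continuous F)
    (hH : AEStronglyMeasurable H (volume.restrict (Ioo 0 T)))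
    (hc : IntegrableOn c (Icc 0 T)) (hHc : ∀ᵐ t ∂(volume.restrict (Icc 0 T)), |H t| ≤ c t)
    (hweak : ∀ χ : ℝ → ℝ, ContDiff ℝ ∞ χ → HasCompactSupport χ → tsupport χ ⊆ Ioo 0 T →
      ∫ t in Ioo 0 T, (F t * deriv χ t + χ t * H t) = 0)
    {s t : ℝ} (hs : 0 ≤ s) (hst : s ≤ t) (ht : t ≤ T) :
    |F t - F s| ≤ ∫ x in s..t, c x := by
  have hP : ContinuousOn (fun x => ∫ y in (0 : ℝ)..x, c y) (Icc 0 T) := by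
    rw [← uIcc_of_le hT.le] at hc ⊢
    exact intervalIntegral.continuousOn_primitive_interval hc
  have hii : ∀ a ∈ Icc 0 T, IntervalIntegrable c volume 0 a := fun a ha =>
    (hc.mono_set (by rw [uIcc_of_le ha.1]; exact Icc_subset_Icc_right ha.2)).intervalIntegrable
  have hPsub : ∀ a ∈ Icc 0 T, ∀ b ∈ Icc 0 T, ∫ x in a..b, c x =
      (∫ y in (0 : ℝ)..b, c y) - ∫ y in (0 : ℝ)..a, c y := fun a ha b hb =>
    (intervalIntegral.integral_interval_sub_left (hii b hb) (hii a ha)).symm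
  have hmid : ∀ s t : ℝ, 0 < s → s < t → t < T → |F t - F s| ≤
      (∫ y in (0 : ℝ)..t, c y) - ∫ y in (0 : ℝ)..s, c y := by
    intro s t hs hst ht
    let φ : ℕ → ContDiffBump (0 : ℝ) := fun n =>
      ⟨1 / ((n : ℝ) + 1) / 2, 1 / ((n : ℝ) + 1), half_pos Nat.one_div_pos_of_nat,
        half_lt_self Nat.one_div_pos_of_nat⟩
    have hφ : Tendsto (fun n => (φ n).rOut) atTop (𝓝 0) := tendsto_one_div_add_atTop_nhds_zero_nat
    have hl : Tendsto (fun n =>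
        |(convolution ((φ n).normed volume) F (ContinuousLinearMap.lsmul ℝ ℝ) volume) s
          - (convolution ((φ n).normed volume) F (ContinuousLinearMap.lsmul ℝ ℝ) volume) t|)
        atTop (𝓝 |F s - F t|) :=
      ((ContDiffBump.convolution_tendsto_right_of_continuous hφ hF s).sub
        (ContDiffBump.convolution_tendsto_right_of_continuous hφ hF t)).abs
    have hPat : ∀ a, 0 < a → a < T → ContinuousAt (fun x => ∫ y in (0 : ℝ)..x, c y) a :=
      fun a h1 h2 => hP.continuousAt (Icc_mem_nhds h1 h2)
    have hr : Tendsto (fun n => (∫ y in (0 : ℝ)..(t + (φ n).rOut), c y) -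
        ∫ y in (0 : ℝ)..(s - (φ n).rOut), c y) atTop
        (𝓝 ((∫ y in (0 : ℝ)..t, c y) - ∫ y in (0 : ℝ)..s, c y)) := by
      refine ((hPat t (hs.trans hst) ht).tendsto.comp ?_).sub
        ((hPat s hs (hst.trans ht)).tendsto.comp ?_)
      · simpa using hφ.const_add t
      · simpa using hφ.const_sub s
    rw [abs_sub_comm]
    refine le_of_tendsto_of_tendsto hl hr ?_
    have hpos : 0 < min s (min ((t - s) / 2) (T - t)) :=
      lt_min hs (lt_min (by linarith) (by linarith))
    filter_upwards [hφ.eventually_lt_const hpos] with n hn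
    have hn1 := hn.trans_le (min_le_left _ _)
    have hn2 := hn.trans_le ((min_le_right _ _).trans (min_le_left _ _))
    have hn3 := hn.trans_le ((min_le_right _ _).trans (min_le_right _ _))
    have hp := (φ n).rOut_pos
    rw [← hPsub _ ⟨by linarith, by linarith⟩ _ ⟨by linarith, by linarith⟩]
    exact abs_convolution_sub_le hF hH hc hHc hweak hn1 (by linarith) (by linarith)
  rcases hst.eq_or_lt with rfl | hlt
  · simp
  have hsm : s ∈ Icc 0 T := ⟨hs, hst.trans ht⟩
  have htm : t ∈ Icc 0 T := ⟨hs.trans hst, ht⟩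
  rw [hPsub s hsm t htm]
  -- contract `[s, t]` towards the midpoint of `[0, T]` to reach the interior
  let γ : ℝ → ℝ → ℝ := fun a δ => a + δ * (T / 2 - a)
  have hγ0 : ∀ a, Tendsto (γ a) (𝓝[>] 0) (𝓝 a) := fun a => by
    have : Continuous (γ a) := by simp only [γ]; fun_prop
    have h := (this.tendsto 0).mono_left (nhdsWithin_le_nhds (s := Ioi 0))
    simpa [γ] using h
  have hIoo : ∀ a ∈ Icc 0 T, ∀ᶠ δ in 𝓝[>] (0 : ℝ), γ a δ ∈ Ioo 0 T := fun a ha => by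
    filter_upwards [Ioo_mem_nhdsGT (zero_lt_one (α := ℝ))] with δ hδ
    simp only [γ]
    constructor
    · nlinarith [hδ.1, hδ.2, ha.1, ha.2]
    · nlinarith [hδ.1, hδ.2, ha.1, ha.2]
  have hPt : ∀ a ∈ Icc 0 T, Tendsto (fun δ => ∫ y in (0 : ℝ)..(γ a δ), c y) (𝓝[>] 0)
      (𝓝 (∫ y in (0 : ℝ)..a, c y)) := fun a ha =>
    (hP a ha).tendsto.comp (tendsto_nhdsWithin_iff.2
      ⟨hγ0 a, (hIoo a ha).mono fun δ hδ => Ioo_subset_Icc_self hδ⟩)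
  refine le_of_tendsto_of_tendsto
    ((((hF.tendsto t).comp (hγ0 t)).sub ((hF.tendsto s).comp (hγ0 s))).abs)
    ((hPt t htm).sub (hPt s hsm)) ?_
  filter_upwards [hIoo s hsm, hIoo t htm, Ioo_mem_nhdsGT (zero_lt_one (α := ℝ))] with δ h1 h2 h3
  refine hmid _ _ h1.1 ?_ h2.2
  simp only [γ]
  nlinarith [h3.1, h3.2]

end WeakDerivative

section MarkovKernel

/-- A narrowly continuous curve of probability measures is a Markov kernel. -/
theorem measurable_of_continuous_probabilityMeasure {X Y : Type*} [TopologicalSpace X]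
    [MeasurableSpace X] [OpensMeasurableSpace X] [TopologicalSpace Y] [HasOuterApproxClosed Y]
    [MeasurableSpace Y] [BorelSpace Y] {Θ : X → ProbabilityMeasure Y} (hΘ : Continuous Θ) :
    Measurable (fun t => (Θ t : Measure Y)) := by
  refine Measurable.measure_of_isPiSystem_of_isProbabilityMeasure
    ((BorelSpace.measurable_eq (α := Y)).trans borel_eq_generateFrom_isClosed)
    isPiSystem_isClosed fun s hs => ?_
  have hs : IsClosed s := hs
  refine measurable_of_tendsto_metrizable (f := fun n t => ∫⁻ y, hs.apprSeq n y ∂(Θ t : Measure Y))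
    (fun n => ?_) (tendsto_pi_nhds.2 fun t => HasOuterApproxClosed.tendsto_lintegral_apprSeq hs _)
  refine Continuous.measurable (continuous_iff_continuousAt.2 fun t => ?_)
  exact ProbabilityMeasure.tendsto_iff_forall_lintegral_tendsto.1 (hΘ.tendsto t) (hs.apprSeq n)

end MarkovKernel

section WeightFlow

variable {α ξ : ℕ} {T : ℝ} {f : EuclideanSpace ℝ (Fin α) → ℝ → EuclideanSpace ℝ (Fin α)}
  {g : EuclideanSpace ℝ (Fin α) → ℝ → Matrix (Fin α) (Fin ξ) ℝ}
  {Θ : ℝ → ProbabilityMeasure (EuclideanSpace ℝ (Fin α))}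

/-- An `L¹(0,T)` function `c` dominates `‖f‖ + ∑ gᵢₖ²` on the ball of radius `R`. -/
theorem AdmissibleCoefficients.exists_bound (hfg : AdmissibleCoefficients T f g) (R : ℝ) :
    ∃ c : ℝ → ℝ, IntegrableOn c (Icc 0 T) ∧ (∀ t, 0 ≤ c t) ∧
      ∀ᵐ t ∂(volume.restrict (Icc 0 T)), ∀ θ, ‖θ‖ ≤ R →
        ‖f θ t‖ + ∑ k, ∑ i, g θ t i k ^ 2 ≤ c t := by
  obtain ⟨a, ha, hfa⟩ := hfg.drift_bound R
  choose b hb hgb using fun i j => hfg.noise_bound i j R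
  refine ⟨fun t => |a t| + ∑ k, ∑ i, b i k t ^ 2, ?_, fun t => by positivity, ?_⟩
  · exact (memLp_one_iff_integrable.1 ha).abs.add
      (integrable_finsetSum _ fun k _ => integrable_finsetSum _ fun i _ => (hb i k).integrable_sq)
  · have hall : ∀ᵐ t ∂(volume.restrict (Icc 0 T)), ∀ i j, ∀ θ, ‖θ‖ ≤ R → ‖g θ t i j‖ ≤ b i j t :=
      ae_all_iff.2 fun i => ae_all_iff.2 fun j => hgb i j
    filter_upwards [hfa, hall] with t h1 h2 θ hθ
    refine add_le_add ((h1 θ hθ).trans (le_abs_self _)) (Finset.sum_le_sum fun k _ =>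
      Finset.sum_le_sum fun i _ => ?_)
    rw [← sq_abs]
    exact pow_le_pow_left₀ (abs_nonneg _) (h2 i k θ hθ) 2

/-- Along a weight flow, the mean of a smooth test function supported in the ball of radius `R` is
absolutely continuous, with a derivative dominated by the `C^{1,1}` size of the function. -/
theorem IsWeightFlow.abs_integral_sub_le_of_contDiff (hT : 0 < T)
    (hfg : AdmissibleCoefficients T f g) (hΘ : IsWeightFlow T f g Θ) {R : ℝ} {c : ℝ → ℝ}
    (hc : IntegrableOn c (Icc 0 T)) (hc0 : ∀ t, 0 ≤ c t)
    (hcb : ∀ᵐ t ∂(volume.restrict (Icc 0 T)), ∀ θ, ‖θ‖ ≤ R →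
        ‖f θ t‖ + ∑ k, ∑ i, g θ t i k ^ 2 ≤ c t)
    {ψ : EuclideanSpace ℝ (Fin α) → ℝ} (hψ : ContDiff ℝ ∞ ψ)
    (hsupp : tsupport ψ ⊆ Metric.closedBall 0 R) {L : ℝ}
    (hL1 : ∀ θ, ‖fderiv ℝ ψ θ‖ ≤ L)
    (hL2 : ∀ θ h, |ψ (θ + h) + ψ (θ - h) - 2 * ψ θ| ≤ L * ‖h‖ ^ 2)
    {s t : ℝ} (hs : 0 ≤ s) (hst : s ≤ t) (ht : t ≤ T) :
    |∫ θ, ψ θ ∂(Θ t : Measure (EuclideanSpace ℝ (Fin α))) -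
      ∫ θ, ψ θ ∂(Θ s : Measure (EuclideanSpace ℝ (Fin α)))| ≤ L * ∫ x in s..t, c x := by
  have hL : 0 ≤ L := (norm_nonneg _).trans (hL1 0)
  have hcψ : HasCompactSupport ψ :=
    (isCompact_closedBall 0 R).of_isClosed_subset (isClosed_tsupport _) hsupp
  -- extend the curve to the real line by its end values: continuity then makes it a kernel, so
  -- that the weak equation can be split into integrals of measurable functions of time
  set Θ' : ℝ → ProbabilityMeasure (EuclideanSpace ℝ (Fin α)) :=
    fun t => Θ (projIcc 0 T hT.le t) with hΘ'
  have hΘ'c : Continuous Θ' := hΘ.continuousOn.domRestrict.comp continuous_projIcc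
  have hΘ'e : ∀ t ∈ Icc 0 T, Θ' t = Θ t := fun t ht => by
    simp only [hΘ', projIcc_of_mem hT.le ht]
  have hmeas := measurable_of_continuous_probabilityMeasure hΘ'c
  let κ : ProbabilityTheory.Kernel ℝ (EuclideanSpace ℝ (Fin α)) :=
    ⟨fun t => (Θ' t : Measure (EuclideanSpace ℝ (Fin α))), hmeas⟩
  have : ProbabilityTheory.IsMarkovKernel κ := ⟨fun t => (Θ' t).2⟩
  have hgen := measurable_generator hfg.drift_measurable hfg.noise_measurable hψ
  set F : ℝ → ℝ := fun t => ∫ θ, ψ θ ∂(Θ' t : Measure (EuclideanSpace ℝ (Fin α))) with hFdef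
  set H : ℝ → ℝ := fun t => ∫ θ, generator f g ψ θ t ∂(Θ' t : Measure (EuclideanSpace ℝ (Fin α)))
    with hHdef
  have hFc : Continuous F := by
    let ψb : BoundedContinuousFunction (EuclideanSpace ℝ (Fin α)) ℝ :=
      BoundedContinuousFunction.ofNormedAddCommGroup ψ hψ.continuous
        (hcψ.exists_bound_of_continuous hψ.continuous).choose
        (hcψ.exists_bound_of_continuous hψ.continuous).choose_spec
    exact (ProbabilityMeasure.continuous_integral_boundedContinuousFunction ψb).comp hΘ'c
  have hHm : StronglyMeasurable H := by
    have h1 : StronglyMeasurable (fun z : ℝ × EuclideanSpace ℝ (Fin α) =>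
        generator f g ψ z.2 z.1) := (hgen.comp measurable_swap).stronglyMeasurable
    exact h1.integral_kernel_prod_right' (κ := κ)
  have hpt : ∀ᵐ t ∂(volume.restrict (Icc 0 T)), ∀ θ, |generator f g ψ θ t| ≤ L * c t := by
    filter_upwards [hcb] with t ht θ
    by_cases hθ : θ ∈ tsupport ψ
    · exact (abs_generator_le hψ hL1 hL2 θ t).trans
        (mul_le_mul_of_nonneg_left (ht θ (by simpa using hsupp hθ)) hL)
    · rw [generator_eq_zero hθ]
      simpa using mul_nonneg hL (hc0 t)
  have hHb : ∀ᵐ t ∂(volume.restrict (Icc 0 T)), |H t| ≤ L * c t := by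
    filter_upwards [hpt] with t ht
    have := norm_integral_le_of_norm_le_const
      (μ := (Θ' t : Measure (EuclideanSpace ℝ (Fin α)))) (C := L * c t) (f := fun θ => generator f g ψ θ t)
      (Eventually.of_forall ht)
    simpa using this
  have hweak : ∀ χ : ℝ → ℝ, ContDiff ℝ ∞ χ → HasCompactSupport χ → tsupport χ ⊆ Ioo 0 T →
      ∫ t in Ioo 0 T, (F t * deriv χ t + χ t * H t) = 0 := by
    intro χ hχ hχc hχs
    have hts : tsupport (fun z : EuclideanSpace ℝ (Fin α) × ℝ => ψ z.1 * χ z.2) ⊆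
        tsupport ψ ×ˢ tsupport χ := by
      refine closure_minimal (fun z hz => ?_) ((isClosed_tsupport _).prod (isClosed_tsupport _))
      have hz : ψ z.1 * χ z.2 ≠ 0 := hz
      exact ⟨subset_tsupport _ (left_ne_zero_of_mul hz),
        subset_tsupport _ (right_ne_zero_of_mul hz)⟩
    have h := hΘ.weak_eq (fun z => ψ z.1 * χ z.2)
      ((hψ.comp contDiff_fst).mul (hχ.comp contDiff_snd))
      ((hcψ.isCompact.prod hχc.isCompact).of_isClosed_subset (isClosed_tsupport _) hts)
      (hts.trans (prod_mono (subset_univ _) hχs))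
    refine Eq.trans (integral_congr_ae ?_) h
    filter_upwards [ae_restrict_of_ae_restrict_of_subset Ioo_subset_Icc_self hpt,
      ae_restrict_mem measurableSet_Ioo] with t h1 h2
    simp only [kolmogorovOperator_mul hψ]
    rw [hFdef, hHdef]
    simp only [hΘ'e t (Ioo_subset_Icc_self h2)]
    have i1 : Integrable (fun θ => ψ θ * deriv χ t)
        (Θ t : Measure (EuclideanSpace ℝ (Fin α))) :=
      (hψ.continuous.integrable_of_hasCompactSupport hcψ).mul_const _
    have i2 : Integrable (fun θ => χ t * generator f g ψ θ t)
        (Θ t : Measure (EuclideanSpace ℝ (Fin α))) :=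
      (Integrable.of_bound (hgen.comp (measurable_id.prodMk
        measurable_const)).aestronglyMeasurable (L * c t) (Eventually.of_forall h1)).const_mul _
    rw [integral_add i1 i2, integral_mul_const, integral_const_mul]
  have := abs_sub_le_integral_of_weak_deriv hT hFc hHm.aestronglyMeasurable (hc.const_mul L) hHb
    hweak hs hst ht
  rw [intervalIntegral.integral_const_mul] at this
  simpa only [hFdef, hΘ'e t ⟨hs.trans hst, ht⟩, hΘ'e s ⟨hs, hst.trans ht⟩] using this

end WeightFlow

/-! ### Regularity of the energy in time -/

section Mollification

theorem integral_add_sub_two_mul {X : Type*} [MeasurableSpace X] {ν : Measure X} {a b c : X → ℝ}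
    (ha : Integrable a ν) (hb : Integrable b ν) (hc : Integrable c ν) :
    (∫ x, a x ∂ν) + (∫ x, b x ∂ν) - 2 * ∫ x, c x ∂ν = ∫ x, (a x + b x - 2 * c x) ∂ν := by
  have hab : Integrable (fun x => a x + b x) ν := ha.add hb
  rw [← integral_const_mul, ← integral_add ha hb, ← integral_sub hab (hc.const_mul 2)]

variable {E : Type*} [NormedAddCommGroup E] [NormedSpace ℝ E] [FiniteDimensional ℝ E]
  [MeasurableSpace E] [BorelSpace E]

theorem ContDiffBump.abs_integral_normed_mul_le {ν : Measure E} [IsLocallyFiniteMeasure ν]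
    [ν.IsOpenPosMeasure] (φ : ContDiffBump (0 : E)) {k : E → ℝ} {C : ℝ} (hk : ∀ η, |k η| ≤ C) :
    |∫ η, φ.normed ν η * k η ∂ν| ≤ C := by
  have h := norm_integral_le_of_norm_le (μ := ν) (f := fun η => φ.normed ν η * k η)
    (φ.integrable_normed.mul_const C) (Eventually.of_forall fun η => by
      rw [norm_mul, Real.norm_eq_abs, Real.norm_eq_abs, abs_of_nonneg (φ.nonneg_normed η)]
      exact mul_le_mul_of_nonneg_left (hk η) (φ.nonneg_normed η))
  rwa [integral_mul_const, φ.integral_normed, one_mul] at h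

/-- Mollification keeps bounds on first and second differences, since these are stable under
averages of translates. -/
theorem exists_contDiff_approx {Φ : E → ℝ} {L₁ L₂ R : ℝ}
    (hΦ1 : ∀ θ η, |Φ θ - Φ η| ≤ L₁ * ‖θ - η‖)
    (hΦ2 : ∀ θ h, |Φ (θ + h) + Φ (θ - h) - 2 * Φ θ| ≤ L₂ * ‖h‖ ^ 2)
    (hΦ0 : ∀ θ, R < ‖θ‖ → Φ θ = 0) (hL : 0 ≤ L₁) {ε : ℝ} (hε : 0 < ε) (hε1 : ε ≤ 1) :
    ∃ ψ : E → ℝ, ContDiff ℝ ∞ ψ ∧ tsupport ψ ⊆ Metric.closedBall 0 (R + 1) ∧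
      (∀ θ, ‖fderiv ℝ ψ θ‖ ≤ L₁) ∧
      (∀ θ h, |ψ (θ + h) + ψ (θ - h) - 2 * ψ θ| ≤ L₂ * ‖h‖ ^ 2) ∧
      ∀ θ, |ψ θ - Φ θ| ≤ L₁ * ε := by
  set ν : Measure E := Measure.addHaar
  set φ : ContDiffBump (0 : E) := ⟨ε / 2, ε, half_pos hε, half_lt_self hε⟩
  have hlip : LipschitzWith ⟨L₁, hL⟩ Φ := LipschitzWith.of_dist_le_mul fun θ η => by
    rw [Real.dist_eq, dist_eq_norm]
    exact hΦ1 θ η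
  have hc : Continuous Φ := hlip.continuous
  set ψ : E → ℝ := convolution (φ.normed ν) Φ (ContinuousLinearMap.lsmul ℝ ℝ) ν with hψ
  have hval : ∀ θ, ψ θ = ∫ η, φ.normed ν η * Φ (θ - η) ∂ν := fun θ => by
    rw [hψ, convolution_lsmul]
    rfl
  have hφc : Continuous (φ.normed ν) := φ.continuous_normed
  have hi : ∀ θ, Integrable (fun η => φ.normed ν η * Φ (θ - η)) ν := fun θ =>
    Continuous.integrable_of_hasCompactSupport (by fun_prop)
      φ.hasCompactSupport_normed.mul_right
  refine ⟨ψ, φ.hasCompactSupport_normed.contDiff_convolution_left _ φ.contDiff_normed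
    hc.locallyIntegrable, ?_, ?_, ?_, ?_⟩
  · refine closure_minimal (fun θ hθ => ?_) Metric.isClosed_closedBall
    by_contra hlt
    rw [mem_closedBall_zero_iff, not_le] at hlt
    have hz : ∀ η ∈ Metric.ball θ φ.rOut, Φ η = 0 := fun η hη => by
      refine hΦ0 η ?_
      have h1 : ‖η - θ‖ < ε := by simpa [dist_eq_norm] using hη
      have h2 := norm_sub_norm_le θ η
      rw [norm_sub_rev] at h2
      linarith
    have h3 := hz θ (Metric.mem_ball_self φ.rOut_pos)
    refine hθ ?_
    rw [hψ, φ.normed_convolution_eq_right (fun η hη => (hz η hη).trans h3.symm), h3]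
  · intro θ
    refine norm_fderiv_le_of_lipschitz ℝ (C := ⟨L₁, hL⟩) (LipschitzWith.of_dist_le_mul
      fun θ η => ?_)
    rw [Real.dist_eq, hval, hval, ← integral_sub (hi _) (hi _)]
    simp_rw [← mul_sub]
    refine φ.abs_integral_normed_mul_le fun ζ => ?_
    have := hΦ1 (θ - ζ) (η - ζ)
    rwa [sub_sub_sub_cancel_right, ← dist_eq_norm] at this
  · intro θ h
    have e : ψ (θ + h) + ψ (θ - h) - 2 * ψ θ = ∫ η, φ.normed ν η *
        (Φ (θ - η + h) + Φ (θ - η - h) - 2 * Φ (θ - η)) ∂ν := by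
      rw [hval, hval, hval, integral_add_sub_two_mul (hi _) (hi _) (hi _)]
      refine integral_congr_ae (Eventually.of_forall fun η => ?_)
      simp only [add_sub_right_comm θ h η, sub_right_comm θ h η]
      ring
    rw [e]
    exact φ.abs_integral_normed_mul_le fun ζ => hΦ2 (θ - ζ) h
  · intro θ
    refine φ.dist_normed_convolution_le hc.aestronglyMeasurable fun η hη => ?_
    rw [Real.dist_eq]
    refine (hΦ1 η θ).trans (mul_le_mul_of_nonneg_left ?_ hL)
    rw [← dist_eq_norm]
    exact (Metric.mem_ball.1 hη).le

end Mollification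

section Kernel

variable {d α : ℕ} {K : UnitSphere d → UnitSphere d → EuclideanSpace ℝ (Fin α) → ℝ}

/-- A `C²` function with second derivative bounded by `B` has second differences bounded by
`2 B ‖h‖²`. -/
theorem abs_second_difference_le {E : Type*} [NormedAddCommGroup E] [NormedSpace ℝ E] {ψ : E → ℝ}
    (hψ : ContDiff ℝ 2 ψ) {B : ℝ} (hB : ∀ θ, ‖fderiv ℝ (fderiv ℝ ψ) θ‖ ≤ B) (θ h : E) :
    |ψ (θ + h) + ψ (θ - h) - 2 * ψ θ| ≤ 2 * B * ‖h‖ ^ 2 := by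
  have hB0 : 0 ≤ B := (norm_nonneg (fderiv ℝ (fderiv ℝ ψ) θ)).trans (hB θ)
  have hd : Differentiable ℝ ψ := hψ.differentiable two_ne_zero
  have hd2 : Differentiable ℝ (fderiv ℝ ψ) :=
    (hψ.fderiv_right (m := 1) le_rfl).differentiable one_ne_zero
  have hlip : ∀ x y, ‖fderiv ℝ ψ x - fderiv ℝ ψ y‖ ≤ B * ‖x - y‖ := fun x y =>
    convex_univ.norm_image_sub_le_of_norm_fderiv_le (fun z _ => hd2 z) (fun z _ => hB z)
      (mem_univ y) (mem_univ x)
  set q : ℝ → ℝ := fun s => ψ (θ + s • h) + ψ (θ - s • h) with hq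
  have hl : ∀ s : ℝ, HasDerivAt (fun s : ℝ => θ + s • h) h s := fun s => by
    simpa using ((hasDerivAt_id s).smul_const h).const_add θ
  have hl' : ∀ s : ℝ, HasDerivAt (fun s : ℝ => θ - s • h) (-h) s := fun s => by
    simpa using ((hasDerivAt_id s).smul_const h).const_sub θ
  have hqd : ∀ s, HasDerivAt q ((fderiv ℝ ψ (θ + s • h) - fderiv ℝ ψ (θ - s • h)) h) s := by
    intro s
    have e1 : HasDerivAt (fun s : ℝ => ψ (θ + s • h)) (fderiv ℝ ψ (θ + s • h) h) s :=
      (hd (θ + s • h)).hasFDerivAt.comp_hasDerivAt s (hl s)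
    have e2 : HasDerivAt (fun s : ℝ => ψ (θ - s • h)) (-fderiv ℝ ψ (θ - s • h) h) s := by
      rw [← map_neg]
      exact (hd (θ - s • h)).hasFDerivAt.comp_hasDerivAt s (hl' s)
    rw [sub_apply, sub_eq_add_neg]
    exact e1.add e2
  have hb : ∀ s ∈ Icc (0 : ℝ) 1,
      ‖(fderiv ℝ ψ (θ + s • h) - fderiv ℝ ψ (θ - s • h)) h‖ ≤ 2 * B * ‖h‖ ^ 2 := by
    intro s hs
    refine (ContinuousLinearMap.le_opNorm _ _).trans ?_
    have h1 := hlip (θ + s • h) (θ - s • h)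
    have h2 : θ + s • h - (θ - s • h) = (2 * s) • h := by
      rw [two_mul, add_smul]
      abel
    rw [h2, norm_smul, Real.norm_eq_abs, abs_of_nonneg (by linarith [hs.1])] at h1
    have h3 : B * (2 * s * ‖h‖) ≤ 2 * B * ‖h‖ := by
      nlinarith [mul_nonneg (mul_nonneg hB0 (norm_nonneg h)) (sub_nonneg.2 hs.2)]
    calc _ ≤ 2 * B * ‖h‖ * ‖h‖ := mul_le_mul_of_nonneg_right (h1.trans h3) (norm_nonneg _)
      _ = 2 * B * ‖h‖ ^ 2 := by ring
  have key := (convex_Icc (0 : ℝ) 1).norm_image_sub_le_of_norm_hasDerivWithin_le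
    (fun s _ => (hqd s).hasDerivWithinAt) hb (left_mem_Icc.2 zero_le_one)
    (right_mem_Icc.2 zero_le_one)
  have e : q 1 - q 0 = ψ (θ + h) + ψ (θ - h) - 2 * ψ θ := by
    simp [hq]
    ring
  rw [e] at key
  simpa using key

theorem AdmissibleKernel.continuous_sphere (hK : AdmissibleKernel K)
    (θ : EuclideanSpace ℝ (Fin α)) :
    Continuous (fun z : UnitSphere d × UnitSphere d => K z.1 z.2 θ) := by
  obtain ⟨F, hF, -, h⟩ := hK.regular_sphere θ
  have hc := hF.continuous
  simp_rw [← h]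
  fun_prop

/-- The kernel averaged over both sphere variables, a function of the weights alone. -/
noncomputable def meanKernel (K : UnitSphere d → UnitSphere d → EuclideanSpace ℝ (Fin α) → ℝ)
    (μ : SphereProb d) (θ : EuclideanSpace ℝ (Fin α)) : ℝ :=
  ∫ x, ∫ y, K x y θ ∂(μ : Measure (UnitSphere d)) ∂(μ : Measure (UnitSphere d))

theorem AdmissibleKernel.integrable (hK : AdmissibleKernel K) (μ : SphereProb d)
    (θ : EuclideanSpace ℝ (Fin α)) :
    Integrable (fun z : UnitSphere d × UnitSphere d => K z.1 z.2 θ)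
      ((μ : Measure (UnitSphere d)).prod (μ : Measure (UnitSphere d))) :=
  (hK.continuous_sphere θ).integrable_of_hasCompactSupport (HasCompactSupport.of_compactSpace _)

theorem AdmissibleKernel.meanKernel_eq (hK : AdmissibleKernel K) (μ : SphereProb d)
    (θ : EuclideanSpace ℝ (Fin α)) : meanKernel K μ θ =
      ∫ z, K z.1 z.2 θ ∂((μ : Measure (UnitSphere d)).prod (μ : Measure (UnitSphere d))) :=
  (integral_prod _ (hK.integrable μ θ)).symm

theorem abs_integral_prod_le (μ : SphereProb d) {k : UnitSphere d × UnitSphere d → ℝ} {C : ℝ}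
    (h : ∀ z, |k z| ≤ C) :
    |∫ z, k z ∂((μ : Measure (UnitSphere d)).prod (μ : Measure (UnitSphere d)))| ≤ C := by
  have := norm_integral_le_of_norm_le_const
    (μ := (μ : Measure (UnitSphere d)).prod (μ : Measure (UnitSphere d))) (C := C) (f := k)
    (Eventually.of_forall h)
  simpa using this

/-- The averaged kernel inherits the bounds of `K`, uniformly in the measure. A measure `u₀` is
taken only to know that the sphere is nonempty, which fails for `d = 0`. -/
theorem AdmissibleKernel.exists_meanKernel_bounds (hK : AdmissibleKernel K) (u₀ : SphereProb d) :
    ∃ B R M : ℝ, 0 ≤ B ∧ ∀ μ : SphereProb d,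
      (∀ θ η, |meanKernel K μ θ - meanKernel K μ η| ≤ B * ‖θ - η‖) ∧
      (∀ θ h, |meanKernel K μ (θ + h) + meanKernel K μ (θ - h) - 2 * meanKernel K μ θ|
        ≤ 2 * B * ‖h‖ ^ 2) ∧
      (∀ θ, R < ‖θ‖ → meanKernel K μ θ = 0) ∧ ∀ θ, |meanKernel K μ θ| ≤ M := by
  obtain ⟨B, hB⟩ := hK.derivative_bounds
  obtain ⟨C, hC, hCs⟩ := hK.compact_support
  obtain ⟨R, hR⟩ := hC.isBounded.subset_closedBall 0
  obtain ⟨M, hM⟩ := isCompact_univ.exists_bound_of_continuousOn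
    (hK.continuous_sphere 0).continuousOn
  have hM : ∀ x y, |K x y 0| ≤ M := fun x y => hM (x, y) (mem_univ _)
  have hne : Nonempty (UnitSphere d) := u₀.nonempty
  have x₀ : UnitSphere d := Classical.arbitrary _
  have hB0 : 0 ≤ B := (norm_nonneg _).trans (hB x₀ x₀ 0).1
  have hM0 : 0 ≤ M := (abs_nonneg _).trans (hM x₀ x₀)
  have hlip : ∀ x y θ η, |K x y θ - K x y η| ≤ B * ‖θ - η‖ := fun x y θ η =>
    convex_univ.norm_image_sub_le_of_norm_fderiv_le
      (fun z _ => (hK.regular_weight x y).differentiable two_ne_zero z)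
      (fun z _ => (hB x y z).1) (mem_univ η) (mem_univ θ)
  have hzero : ∀ x y θ, R < ‖θ‖ → K x y θ = 0 := fun x y θ hθ => by
    by_contra hne
    have := hR (hCs x y (subset_tsupport _ hne))
    rw [mem_closedBall_zero_iff] at this
    linarith
  refine ⟨B, R, M + B * |R|, hB0, fun μ => ⟨fun θ η => ?_, fun θ h => ?_, fun θ hθ => ?_,
    fun θ => ?_⟩⟩
  · rw [hK.meanKernel_eq, hK.meanKernel_eq, ← integral_sub (hK.integrable μ θ) (hK.integrable μ η)]
    exact abs_integral_prod_le μ fun z => hlip _ _ _ _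
  · rw [hK.meanKernel_eq, hK.meanKernel_eq, hK.meanKernel_eq,
      integral_add_sub_two_mul (hK.integrable μ _) (hK.integrable μ _) (hK.integrable μ _)]
    exact abs_integral_prod_le μ fun z =>
      abs_second_difference_le (hK.regular_weight _ _) (fun θ => (hB _ _ θ).2) θ h
  · simp [meanKernel, hzero _ _ θ hθ]
  · rw [hK.meanKernel_eq]
    refine abs_integral_prod_le μ fun z => ?_
    by_cases hθ : R < ‖θ‖
    · rw [hzero _ _ θ hθ, abs_zero]
      positivity
    · have h1 := hlip z.1 z.2 θ 0
      rw [sub_zero] at h1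
      have h2 : B * ‖θ‖ ≤ B * |R| :=
        mul_le_mul_of_nonneg_left ((not_lt.1 hθ).trans (le_abs_self R)) hB0
      have h3 := abs_sub_abs_le_abs_sub (K z.1 z.2 θ) (K z.1 z.2 0)
      linarith [hM z.1 z.2]

end Kernel

section Energy

variable {d α ξ : ℕ} {T : ℝ} {f : EuclideanSpace ℝ (Fin α) → ℝ → EuclideanSpace ℝ (Fin α)}
  {g : EuclideanSpace ℝ (Fin α) → ℝ → Matrix (Fin α) (Fin ξ) ℝ}
  {Θ : ℝ → ProbabilityMeasure (EuclideanSpace ℝ (Fin α))}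
  {K : UnitSphere d → UnitSphere d → EuclideanSpace ℝ (Fin α) → ℝ}

/-- The energy is bounded, and absolutely continuous in time uniformly in the measure. -/
theorem exists_energy_bounds (hT : 0 < T) (hfg : AdmissibleCoefficients T f g)
    (hΘ : IsWeightFlow T f g Θ) (hK : AdmissibleKernel K) (u₀ : SphereProb d) :
    ∃ (M : ℝ) (c : ℝ → ℝ), IntegrableOn c (Icc 0 T) ∧
      (∀ μ : SphereProb d, ∀ t, |interactionEnergy K Θ μ t| ≤ M) ∧
      ∀ μ : SphereProb d, ∀ s t, 0 ≤ s → s ≤ t → t ≤ T →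
        |interactionEnergy K Θ μ t - interactionEnergy K Θ μ s| ≤ ∫ x in s..t, c x := by
  obtain ⟨B, R, M, hB, hbd⟩ := hK.exists_meanKernel_bounds u₀
  obtain ⟨c, hc, hc0, hcb⟩ := hfg.exists_bound (R + 1)
  have hE : ∀ (μ : SphereProb d) t, interactionEnergy K Θ μ t = (1 / 2 : ℝ) *
      ∫ θ, meanKernel K μ θ ∂(Θ t : Measure (EuclideanSpace ℝ (Fin α))) := fun μ t => rfl
  refine ⟨M, fun t => 2 * B * c t, hc.const_mul _, fun μ t => ?_, fun μ s t hs hst ht => ?_⟩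
  · have h1 := norm_integral_le_of_norm_le_const
      (μ := (Θ t : Measure (EuclideanSpace ℝ (Fin α)))) (C := M) (f := meanKernel K μ)
      (Eventually.of_forall (hbd μ).2.2.2)
    have h2 : |∫ θ, meanKernel K μ θ ∂(Θ t : Measure (EuclideanSpace ℝ (Fin α)))| ≤ M := by
      simpa using h1
    rw [hE, abs_mul, abs_of_pos (by norm_num : (0 : ℝ) < 1 / 2)]
    linarith [abs_nonneg (∫ θ, meanKernel K μ θ ∂(Θ t : Measure (EuclideanSpace ℝ (Fin α))))]
  · obtain ⟨h1, h2, h3, h4⟩ := hbd μ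
    have hcont : Continuous (meanKernel K μ) :=
      (LipschitzWith.of_dist_le_mul (K := ⟨B, hB⟩) fun θ η => by
        rw [Real.dist_eq, dist_eq_norm]
        exact h1 θ η).continuous
    have hint : ∀ t, Integrable (meanKernel K μ)
        (Θ t : Measure (EuclideanSpace ℝ (Fin α))) := fun t =>
      Integrable.of_bound hcont.aestronglyMeasurable M (Eventually.of_forall h4)
    have key : |∫ θ, meanKernel K μ θ ∂(Θ t : Measure (EuclideanSpace ℝ (Fin α))) -
        ∫ θ, meanKernel K μ θ ∂(Θ s : Measure (EuclideanSpace ℝ (Fin α)))|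
        ≤ ∫ x in s..t, 2 * B * c x := by
      rw [intervalIntegral.integral_const_mul]
      -- the smooth estimate for a mollification, with the error of approximation at both times
      have happ : ∀ ε : ℝ, 0 < ε → ε ≤ 1 →
          |∫ θ, meanKernel K μ θ ∂(Θ t : Measure (EuclideanSpace ℝ (Fin α))) -
            ∫ θ, meanKernel K μ θ ∂(Θ s : Measure (EuclideanSpace ℝ (Fin α)))|
          ≤ 2 * B * (∫ x in s..t, c x) + 2 * (B * ε) := by
        intro ε hε hε1
        obtain ⟨ψ, hψ, hψs, hψ1, hψ2, hψ3⟩ := exists_contDiff_approx h1 h2 h3 hB hε hε1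
        have hψi : ∀ t, Integrable ψ (Θ t : Measure (EuclideanSpace ℝ (Fin α))) := fun t =>
          hψ.continuous.integrable_of_hasCompactSupport
            ((isCompact_closedBall 0 (R + 1)).of_isClosed_subset (isClosed_tsupport _) hψs)
        have hd : ∀ t, |(∫ θ, ψ θ ∂(Θ t : Measure (EuclideanSpace ℝ (Fin α)))) -
            ∫ θ, meanKernel K μ θ ∂(Θ t : Measure (EuclideanSpace ℝ (Fin α)))| ≤ B * ε := by
          intro t
          rw [← integral_sub (hψi t) (hint t)]
          have := norm_integral_le_of_norm_le_const
            (μ := (Θ t : Measure (EuclideanSpace ℝ (Fin α)))) (C := B * ε)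
            (f := fun θ => ψ θ - meanKernel K μ θ) (Eventually.of_forall hψ3)
          simpa using this
        have hm := hΘ.abs_integral_sub_le_of_contDiff hT hfg hc hc0 hcb hψ hψs (L := 2 * B)
          (fun θ => (hψ1 θ).trans (by linarith)) hψ2 hs hst ht
        have a1 := abs_le.1 (hd t)
        have a2 := abs_le.1 (hd s)
        have a3 := abs_le.1 hm
        rw [abs_le]
        exact ⟨by linarith, by linarith⟩
      refine ge_of_tendsto (x := 𝓝[>] (0 : ℝ))
        (f := fun ε => 2 * B * (∫ x in s..t, c x) + 2 * (B * ε)) ?_ ?_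
      · have : Continuous (fun ε : ℝ => 2 * B * (∫ x in s..t, c x) + 2 * (B * ε)) := by fun_prop
        simpa using (this.tendsto 0).mono_left (nhdsWithin_le_nhds (s := Ioi 0))
      · filter_upwards [Ioc_mem_nhdsGT (zero_lt_one (α := ℝ))] with ε hε
        exact happ ε hε.1 hε.2
    rw [hE, hE, ← mul_sub, abs_mul, abs_of_pos (by norm_num : (0 : ℝ) < 1 / 2)]
    linarith [abs_nonneg (∫ θ, meanKernel K μ θ ∂(Θ t : Measure (EuclideanSpace ℝ (Fin α))) -
        ∫ θ, meanKernel K μ θ ∂(Θ s : Measure (EuclideanSpace ℝ (Fin α))))]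

end Energy

/-! ### Discrete energy estimate and discrete speeds -/

namespace TimePartition

variable {T : ℝ} (τ : TimePartition T)

theorem pt_mono {i j : ℕ} (hij : i ≤ j) (hj : j ≤ τ.N) : τ.pt i ≤ τ.pt j := by
  rcases hij.lt_or_eq with h | rfl
  · exact (τ.pt_lt_of_lt h hj).le
  · exact le_rfl

theorem pt_nonneg {k : ℕ} (hk : k ≤ τ.N) : 0 ≤ τ.pt k := by
  rw [← τ.pt_zero]
  exact τ.pt_mono (Nat.zero_le _) hk

theorem pt_le {k : ℕ} (hk : k ≤ τ.N) : τ.pt k ≤ T := by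
  conv_rhs => rw [← τ.pt_last]
  exact τ.pt_mono hk le_rfl

theorem sub_le_mesh {k : ℕ} (hk : k < τ.N) : τ.pt (k + 1) - τ.pt k ≤ τ.mesh :=
  le_ciSup (f := fun k : Fin τ.N => τ.pt (k + 1) - τ.pt k) (finite_range _).bddAbove ⟨k, hk⟩

theorem mesh_nonneg : 0 ≤ τ.mesh :=
  Real.iSup_nonneg fun k => sub_nonneg.2 (τ.pt_lt k k.2).le

theorem mesh_pos {k : ℕ} (hk : k < τ.N) : 0 < τ.mesh :=
  (sub_pos.2 (τ.pt_lt k hk)).trans_le (τ.sub_le_mesh hk)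

/-- The first index `k` with `t ≤ t_k`, which the interpolation selects. -/
noncomputable def index (t : ℝ) : ℕ := sInf {k : ℕ | t ≤ τ.pt k}

theorem index_le {t : ℝ} (ht : t ≤ T) : τ.index t ≤ τ.N :=
  Nat.sInf_le (by rw [mem_ofPred_eq, τ.pt_last]; exact ht)

theorem le_pt_index {t : ℝ} (ht : t ≤ T) : t ≤ τ.pt (τ.index t) :=
  Nat.sInf_mem (s := {k : ℕ | t ≤ τ.pt k}) ⟨τ.N, by rw [mem_ofPred_eq, τ.pt_last]; exact ht⟩

theorem pt_lt_of_lt_index {t : ℝ} {k : ℕ} (hk : k < τ.index t) : τ.pt k < t :=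
  not_le.1 fun h => Nat.notMem_of_lt_sInf hk h

theorem index_mono {s r : ℝ} (hsr : s ≤ r) (hr : r ≤ T) : τ.index s ≤ τ.index r :=
  Nat.sInf_le (hsr.trans (τ.le_pt_index hr))

end TimePartition

section Scheme

variable {d : ℕ} {T : ℝ} {τ : TimePartition T} {σ : ℕ → ℝ} {U : ℕ → SphereProb d}

/-- Comparing each minimizer with the previous one and summing up bounds the discrete speeds by
the loss of energy along the scheme plus the energy fed in by the time dependence. -/
theorem IsMinimizingMovement.sum_speed_sq_le {E : SphereProb d → ℝ → ℝ} {u₀ : SphereProb d}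
    (hU : IsMinimizingMovement E τ σ u₀ U) (hσ : ∀ k < τ.N, 0 < σ k) {M : ℝ} {c : ℝ → ℝ}
    (hc : IntegrableOn c (Icc 0 T)) (hM : ∀ μ t, |E μ t| ≤ M)
    (hE : ∀ μ s t, 0 ≤ s → s ≤ t → t ≤ T → |E μ t - E μ s| ≤ ∫ x in s..t, c x) :
    ∑ k ∈ Finset.range τ.N, σ k * (W2 (U (k + 1)) (U k) / σ k) ^ 2 ≤
      4 * M + 2 * ∫ x in (0 : ℝ)..T, c x := by
  have hii : ∀ a b, 0 ≤ a → a ≤ b → b ≤ T → IntervalIntegrable c volume a b :=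
    fun a b ha hab hb => (hc.mono_set (by
      rw [uIcc_of_le hab]; exact Icc_subset_Icc ha hb)).intervalIntegrable
  have key : ∀ j ≤ τ.N, ∑ k ∈ Finset.range j, σ k * (W2 (U (k + 1)) (U k) / σ k) ^ 2 / 2 +
      E (U j) (τ.pt j) ≤ E (U 0) 0 + ∫ x in (0 : ℝ)..(τ.pt j), c x := by
    intro j
    induction j with
    | zero => simp [τ.pt_zero]
    | succ j ih =>
      intro hj
      have hj' : j < τ.N := hj
      have h1 := ih hj'.le
      have h2 := hU.minimal j hj' (U j)
      rw [W2_self] at h2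
      have h3 := (abs_le.1 (hE (U j) (τ.pt j) (τ.pt (j + 1)) (τ.pt_nonneg hj'.le)
        (τ.pt_lt j hj').le (τ.pt_le hj))).2
      rw [Finset.sum_range_succ, ← intervalIntegral.integral_add_adjacent_intervals
        (hii 0 (τ.pt j) le_rfl (τ.pt_nonneg hj'.le) (τ.pt_le hj'.le))
        (hii (τ.pt j) (τ.pt (j + 1)) (τ.pt_nonneg hj'.le) (τ.pt_lt j hj').le (τ.pt_le hj))]
      -- `σ (W/σ)² / 2 = W² / (2σ)`: the summand is the penalization term of the scheme
      have h4 : σ j * (W2 (U (j + 1)) (U j) / σ j) ^ 2 / 2 =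
          W2 (U (j + 1)) (U j) ^ 2 / (2 * σ j) := by
        have := (hσ j hj').ne'
        field_simp
      have h5 : (0 : ℝ) ^ 2 / (2 * σ j) = 0 := by simp
      rw [h4]
      linarith
  have h := key τ.N le_rfl
  rw [τ.pt_last, ← Finset.sum_div] at h
  have h1 := (abs_le.1 (hM (U 0) 0)).2
  have h2 := (abs_le.1 (hM (U τ.N) T)).1
  linarith

theorem W2_le_sum (U : ℕ → SphereProb d) {i j : ℕ} (hij : i ≤ j) :
    W2 (U i) (U j) ≤ ∑ k ∈ Finset.Ico i j, W2 (U (k + 1)) (U k) := by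
  induction j, hij using Nat.le_induction with
  | base => simp [W2_self]
  | succ j hij ih =>
    rw [Finset.sum_Ico_succ_top hij, W2_comm (U (j + 1))]
    exact (W2_triangle _ _ _).trans (add_le_add_left ih _)

/-- The discrete speed `W₂(U_{k+1}, U_k) / σ_k`, spread over `(t_k, t_k + σ_k]`. These intervals
overlap when `σ_k` exceeds the current step. -/
noncomputable def discreteSpeed (τ : TimePartition T) (σ : ℕ → ℝ) (U : ℕ → SphereProb d)
    (t : ℝ) : ℝ :=
  ∑ k ∈ Finset.range τ.N,
    (Ioc (τ.pt k) (τ.pt k + σ k)).indicator (fun _ => W2 (U (k + 1)) (U k) / σ k) t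

open Classical in
/-- The number of intervals `(t_k, t_k + σ_k]` that contain `t`. -/
noncomputable def overlap (τ : TimePartition T) (σ : ℕ → ℝ) (t : ℝ) : ℕ :=
  ((Finset.range τ.N).filter fun k => t ∈ Ioc (τ.pt k) (τ.pt k + σ k)).card

theorem memLp_discreteSpeed : MemLp (discreteSpeed τ σ U) 2 volume :=
  memLp_finsetSum _ fun k _ =>
    memLp_indicator_const 2 measurableSet_Ioc _ (Or.inr (by simp [Real.volume_Ioc]))

theorem discreteSpeed_sq_le (t : ℝ) : discreteSpeed τ σ U t ^ 2 ≤ overlap τ σ t *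
    ∑ k ∈ Finset.range τ.N, (Ioc (τ.pt k) (τ.pt k + σ k)).indicator
      (fun _ => (W2 (U (k + 1)) (U k) / σ k) ^ 2) t := by
  classical
  simp only [discreteSpeed, overlap, indicator_apply, ← Finset.sum_filter]
  exact sq_sum_le_card_mul_sum_sq

theorem integral_discreteSpeed_sq_le (hσ : ∀ k < τ.N, 0 < σ k) {M : ℝ}
    (hM : ∀ t, (overlap τ σ t : ℝ) ≤ M) :
    ∫ t, discreteSpeed τ σ U t ^ 2 ≤
      M * ∑ k ∈ Finset.range τ.N, σ k * (W2 (U (k + 1)) (U k) / σ k) ^ 2 := by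
  have hi : ∀ k ∈ Finset.range τ.N, Integrable ((Ioc (τ.pt k) (τ.pt k + σ k)).indicator
      (fun _ => (W2 (U (k + 1)) (U k) / σ k) ^ 2)) := fun k _ =>
    (integrable_indicator_iff measurableSet_Ioc).2 (integrableOn_const (by simp))
  have h1 : ∫ t, discreteSpeed τ σ U t ^ 2 ≤ ∫ t, M *
      ∑ k ∈ Finset.range τ.N, (Ioc (τ.pt k) (τ.pt k + σ k)).indicator
        (fun _ => (W2 (U (k + 1)) (U k) / σ k) ^ 2) t := by
    refine integral_mono memLp_discreteSpeed.integrable_sq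
      ((integrable_finsetSum _ hi).const_mul M) fun t => ?_
    refine (discreteSpeed_sq_le t).trans (mul_le_mul_of_nonneg_right (hM t) ?_)
    exact Finset.sum_nonneg fun k _ => indicator_nonneg (fun _ _ => sq_nonneg _) _
  refine h1.trans (le_of_eq ?_)
  rw [integral_const_mul, integral_finsetSum _ hi]
  congr 1
  refine Finset.sum_congr rfl fun k hk => ?_
  rw [integral_indicator_const _ measurableSet_Ioc, smul_eq_mul, Real.volume_real_Ioc_of_le]
  · ring
  · linarith [hσ k (Finset.mem_range.1 hk)]

/-- The increments of the interpolation are controlled by the integral of the discrete speed,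
up to a delay of one mesh size. -/
theorem W2_interp_le_integral_discreteSpeed (hσ : ∀ k < τ.N, 0 < σ k)
    (hσm : ∀ k < τ.N, σ k ≤ τ.mesh) {s r : ℝ} (hsr : s ≤ r) (hr : r ≤ T) :
    W2 (τ.interp U s) (τ.interp U r) ≤ ∫ x in s..(r + τ.mesh), discreteSpeed τ σ U x := by
  have hle : s ≤ r + τ.mesh := by linarith [τ.mesh_nonneg]
  have hi : ∀ k ∈ Finset.range τ.N, Integrable ((Ioc (τ.pt k) (τ.pt k + σ k)).indicator
      (fun _ => W2 (U (k + 1)) (U k) / σ k)) (volume.restrict (Ioc s (r + τ.mesh))) := fun k _ =>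
    ((integrable_indicator_iff measurableSet_Ioc).2 (integrableOn_const (by simp))).restrict
  rw [intervalIntegral.integral_of_le hle]
  simp only [discreteSpeed]
  rw [integral_finsetSum _ hi]
  have hjN := τ.index_le hr
  calc W2 (τ.interp U s) (τ.interp U r)
      ≤ ∑ k ∈ Finset.Ico (τ.index s) (τ.index r), W2 (U (k + 1)) (U k) :=
        W2_le_sum U (τ.index_mono hsr hr)
    _ = ∑ k ∈ Finset.Ico (τ.index s) (τ.index r), ∫ x in Ioc s (r + τ.mesh),
          (Ioc (τ.pt k) (τ.pt k + σ k)).indicator (fun _ => W2 (U (k + 1)) (U k) / σ k) x := by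
        refine Finset.sum_congr rfl fun k hk => ?_
        rw [Finset.mem_Ico] at hk
        have hkN : k < τ.N := hk.2.trans_le hjN
        have h1 : s ≤ τ.pt k := (τ.le_pt_index (hsr.trans hr)).trans (τ.pt_mono hk.1 hkN.le)
        have h2 : τ.pt k < r := τ.pt_lt_of_lt_index hk.2
        -- so the whole interval of step `k` lies in `(s, r + |τ|]`
        have h3 := hσm k hkN
        have h4 := hσ k hkN
        rw [setIntegral_indicator measurableSet_Ioc, inter_eq_self_of_subset_right
          (Ioc_subset_Ioc h1 (by linarith)), setIntegral_const, smul_eq_mul,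
          Real.volume_real_Ioc_of_le (by linarith)]
        field_simp
        ring
    _ ≤ _ := by
        refine Finset.sum_le_sum_of_subset_of_nonneg (fun k hk => ?_) fun k hk _ => ?_
        · rw [Finset.mem_Ico] at hk
          exact Finset.mem_range.2 (hk.2.trans_le hjN)
        · exact integral_nonneg fun x => indicator_nonneg (fun _ _ =>
            div_nonneg (W2_nonneg _ _) (hσ k (Finset.mem_range.1 hk)).le) _

/-- With penalization by the current step, the intervals `(t_k, t_k + σ_k]` are disjoint. -/
theorem overlap_le_one (hσ : ∀ k < τ.N, σ k = τ.pt (k + 1) - τ.pt k) (t : ℝ) :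
    overlap τ σ t ≤ 1 := by
  classical
  rw [overlap, Finset.card_le_one]
  have key : ∀ i j, i < τ.N → j < τ.N → t ∈ Ioc (τ.pt i) (τ.pt i + σ i) →
      t ∈ Ioc (τ.pt j) (τ.pt j + σ j) → ¬ i < j := by
    intro i j hi hj hti htj hij
    have h1 := τ.pt_mono (Nat.succ_le_of_lt hij) hj.le
    have h2 := hti.2
    rw [hσ i hi] at h2
    linarith [htj.1]
  intro i hi j hj
  rw [Finset.mem_filter, Finset.mem_range] at hi hj
  have h1 := key i j hi.1 hj.1 hi.2 hj.2
  have h2 := key j i hj.1 hi.1 hj.2 hi.2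
  omega

/-- With penalization by the mesh size, the density condition on the partition points bounds the
overlap. -/
theorem overlap_le_of_countIoc (hσ : ∀ k < τ.N, σ k = τ.mesh) {Λ : ℝ}
    (hΛ : ∀ s r : ℝ, 0 ≤ s → s ≤ r → r ≤ T → (τ.countIoc s r : ℝ) ≤ Λ * (1 + (r - s) / τ.mesh))
    (hT : 0 < T) (t : ℝ) :
    (overlap τ σ t : ℝ) ≤ 3 * |Λ| + 1 := by
  classical
  rcases Nat.eq_zero_or_pos (overlap τ σ t) with h0 | h0
  · rw [h0]
    push_cast
    positivity
  obtain ⟨k₀, hk₀⟩ := Finset.card_pos.1 h0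
  rw [Finset.mem_filter, Finset.mem_range] at hk₀
  have hm := τ.mesh_pos hk₀.1
  have ht : 0 ≤ t := (τ.pt_nonneg hk₀.1.le).trans hk₀.2.1.le
  -- twice the mesh size, as `countIoc` leaves out the left end point
  set s := min T (max 0 (t - 2 * τ.mesh)) with hs
  set r := min T t with hr
  have hs0 : 0 ≤ s := le_min hT.le (le_max_left _ _)
  have hsr : s ≤ r := min_le_min le_rfl (max_le ht (by linarith))
  have hrs : r - s ≤ 2 * τ.mesh := by
    rcases le_total T (max 0 (t - 2 * τ.mesh)) with h | h
    · rw [hs, min_eq_left h]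
      linarith [min_le_left T t]
    · rw [hs, min_eq_right h]
      linarith [min_le_right T t, le_max_right 0 (t - 2 * τ.mesh)]
  have hcount : (τ.countIoc s r : ℝ) ≤ 3 * |Λ| := by
    have h1 : 0 ≤ (r - s) / τ.mesh := div_nonneg (sub_nonneg.2 hsr) hm.le
    have h2 : (r - s) / τ.mesh ≤ 2 := (div_le_iff₀ hm).2 hrs
    calc (τ.countIoc s r : ℝ) ≤ Λ * (1 + (r - s) / τ.mesh) := hΛ s r hs0 hsr (min_le_left _ _)
      _ ≤ |Λ| * (1 + (r - s) / τ.mesh) :=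
        mul_le_mul_of_nonneg_right (le_abs_self Λ) (by linarith)
      _ ≤ |Λ| * 3 := mul_le_mul_of_nonneg_left (by linarith) (abs_nonneg _)
      _ = 3 * |Λ| := mul_comm _ _
  have hcard : overlap τ σ t ≤ τ.countIoc s r + 1 := by
    set A := (Finset.range τ.N).filter fun k => τ.pt (k + 1) ∈ Ioc s r with hA
    have hA' : τ.countIoc s r = A.card := by
      rw [TimePartition.countIoc, ← ncard_coe_finset]
      congr 1
      ext k
      simp [hA]
    rw [hA', overlap]
    refine (Finset.card_le_card (t := insert 0 (A.image (· + 1))) fun k hk => ?_).trans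
      ((Finset.card_insert_le _ _).trans (Nat.add_le_add_right Finset.card_image_le 1))
    rw [Finset.mem_filter, Finset.mem_range] at hk
    obtain ⟨hkN, hk1, hk2⟩ := hk
    rw [hσ k hkN] at hk2
    rcases k with _ | k
    · exact Finset.mem_insert_self _ _
    -- `countIoc` counts the points `t_{k+1}`, which misses only `t_0`
    · refine Finset.mem_insert_of_mem (Finset.mem_image.2 ⟨k, ?_, rfl⟩)
      have h0 : 0 < τ.pt (k + 1) := by
        rw [← τ.pt_zero]
        exact τ.pt_lt_of_lt (Nat.succ_pos k) hkN.le
      rw [hA, Finset.mem_filter, Finset.mem_range]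
      exact ⟨by omega, (min_le_right _ _).trans_lt (max_lt h0 (by linarith)),
        le_min (τ.pt_le hkN.le) hk1.le⟩
  have : (overlap τ σ t : ℝ) ≤ (τ.countIoc s r : ℝ) + 1 := by exact_mod_cast hcard
  linarith

/-- The discrete speed as an element of `L²(ℝ)`: it is bounded by the overlap and the discrete
energy estimate, and controls the increments of the interpolation. -/
theorem exists_discreteSpeed_Lp (hσ : ∀ k < τ.N, 0 < σ k) (hσm : ∀ k < τ.N, σ k ≤ τ.mesh) {M C : ℝ}
    (hM : ∀ t, (overlap τ σ t : ℝ) ≤ M)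
    (hC : ∑ k ∈ Finset.range τ.N, σ k * (W2 (U (k + 1)) (U k) / σ k) ^ 2 ≤ C) :
    ∃ V : Lp ℝ 2 (volume : Measure ℝ), ‖V‖ ≤ Real.sqrt (M * C) ∧ ∀ s r, s ≤ r → r ≤ T →
      W2 (τ.interp U s) (τ.interp U r) ≤ ∫ x in s..(r + τ.mesh), V x := by
  have hM0 : 0 ≤ M := (Nat.cast_nonneg _).trans (hM 0)
  refine ⟨memLp_discreteSpeed.toLp (discreteSpeed τ σ U), ?_, fun s r hsr hr => ?_⟩
  · refine Real.le_sqrt_of_sq_le ?_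
    refine le_trans (le_of_eq ?_) ((integral_discreteSpeed_sq_le (U := U) hσ hM).trans
      (mul_le_mul_of_nonneg_left hC hM0))
    rw [← real_inner_self_eq_norm_sq, L2.inner_def]
    refine integral_congr_ae ?_
    filter_upwards [memLp_discreteSpeed.coeFn_toLp (f := discreteSpeed τ σ U)] with t ht
    rw [ht, real_inner_self_eq_norm_sq, Real.norm_eq_abs, sq_abs]
  · refine (W2_interp_le_integral_discreteSpeed hσ hσm hsr hr).trans (le_of_eq ?_)
    refine intervalIntegral.integral_congr_ae ?_
    filter_upwards [memLp_discreteSpeed.coeFn_toLp (f := discreteSpeed τ σ U)] with t ht _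
    exact ht.symm

end Scheme

/-! ### Compactness of curves with speeds bounded in `L²` -/

section Compactness

/-- Bounded sequences in `L²(ℝ)` converge weakly along an ultrafilter, by the Banach-Alaoglu
theorem and Riesz representation. -/
theorem exists_weak_limit {V : ℕ → Lp ℝ 2 (volume : Measure ℝ)} {C : ℝ} (hV : ∀ n, ‖V n‖ ≤ C)
    (F : Ultrafilter ℕ) :
    ∃ m : Lp ℝ 2 (volume : Measure ℝ), ∀ h, Tendsto (fun n => inner ℝ h (V n)) F
      (𝓝 (inner ℝ h m)) := by
  let D := InnerProductSpace.toDual ℝ (Lp ℝ 2 (volume : Measure ℝ))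
  let x : ℕ → WeakDual ℝ (Lp ℝ 2 (volume : Measure ℝ)) := fun n =>
    StrongDual.toWeakDual (D (V n))
  have hmem : ∀ n, x n ∈ WeakDual.toStrongDual ⁻¹'
      Metric.closedBall (0 : StrongDual ℝ (Lp ℝ 2 (volume : Measure ℝ))) C := by
    intro n
    simp only [mem_preimage, mem_closedBall_zero_iff]
    change ‖D (V n)‖ ≤ C
    rw [LinearIsometryEquiv.norm_map]
    exact hV n
  obtain ⟨ℓ, -, hℓ⟩ := (WeakDual.isCompact_closedBall
    (0 : StrongDual ℝ (Lp ℝ 2 (volume : Measure ℝ))) C).ultrafilter_le_nhds (F.map x)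
    (Filter.le_principal_iff.2 (Filter.mem_map.2 (Filter.univ_mem' hmem)))
  have hℓ : Tendsto x F (𝓝 ℓ) := hℓ
  refine ⟨D.symm (WeakDual.toStrongDual ℓ), fun h => ?_⟩
  have h1 : Tendsto (fun n => x n h) F (𝓝 (ℓ h)) :=
    ((WeakDual.eval_continuous h).tendsto ℓ).comp hℓ
  have h2 : ∀ n, x n h = inner ℝ h (V n) := fun n => by
    rw [real_inner_comm]
    exact InnerProductSpace.toDual_apply_apply
  have h3 : ℓ h = inner ℝ h (D.symm (WeakDual.toStrongDual ℓ)) := by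
    rw [real_inner_comm]
    exact InnerProductSpace.toDual_symm_apply.symm
  simp_rw [h2, h3] at h1
  exact h1

theorem intervalIntegral_eq_inner (V : Lp ℝ 2 (volume : Measure ℝ)) {s r : ℝ} (hsr : s ≤ r) :
    ∫ x in s..r, V x = inner ℝ (indicatorConstLp 2 (measurableSet_Ioc (a := s) (b := r))
      measure_Ioc_lt_top.ne (1 : ℝ)) V := by
  rw [L2.inner_indicatorConstLp_one, intervalIntegral.integral_of_le hsr]

theorem intervalIntegral_le_norm_mul_sqrt (V : Lp ℝ 2 (volume : Measure ℝ)) {s r : ℝ}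
    (hsr : s ≤ r) : ∫ x in s..r, V x ≤ ‖V‖ * Real.sqrt (r - s) := by
  rw [intervalIntegral_eq_inner V hsr, mul_comm]
  refine (real_inner_le_norm _ _).trans (mul_le_mul_of_nonneg_right ?_ (norm_nonneg _))
  rw [norm_indicatorConstLp two_ne_zero ENNReal.ofNat_ne_top, Real.volume_real_Ioc_of_le hsr,
    Real.sqrt_eq_rpow]
  simp

variable {d : ℕ} {T : ℝ}

/-- If increments are controlled up to a vanishing delay by speeds bounded in `L²`, a subsequence
of the curves converges narrowly at every time. Diagonal extraction gives convergence at the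
rational times; equicontinuity with respect to `W₂` makes the cluster point unique at the
others. -/
theorem exists_subseq_tendsto (hT : 0 < T) {u : ℕ → ℝ → SphereProb d} {C : ℝ} (hC : 0 ≤ C)
    {δ : ℕ → ℝ} (hδ : Tendsto δ atTop (𝓝 0))
    (h : ∀ n s r, 0 ≤ s → s ≤ r → r ≤ T → W2 (u n s) (u n r) ≤ C * Real.sqrt (r + δ n - s)) :
    ∃ φ : ℕ → ℕ, StrictMono φ ∧ ∀ t ∈ Icc 0 T, ∃ p, Tendsto (fun n => u (φ n) t) atTop (𝓝 p) := by
  obtain ⟨x, φ, hφ, hx⟩ := SeqCompactSpace.tendsto_subseq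
    (fun n (q : ℚ) => u n (projIcc 0 T hT.le (q : ℝ)))
  rw [tendsto_pi_nhds] at hx
  refine ⟨φ, hφ, fun t ht => ?_⟩
  have hδφ := hδ.comp hφ.tendsto_atTop
  have hsymm : ∀ n s r, s ∈ Icc 0 T → r ∈ Icc 0 T →
      W2 (u n s) (u n r) ≤ C * Real.sqrt (|r - s| + δ n) := by
    intro n s r hs hr
    rcases le_total s r with hsr | hsr
    · have := h n s r hs.1 hsr hr.2
      rwa [abs_of_nonneg (sub_nonneg.2 hsr), sub_add_eq_add_sub]
    · have := h n r s hr.1 hsr hs.2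
      rwa [abs_sub_comm, abs_of_nonneg (sub_nonneg.2 hsr), sub_add_eq_add_sub, W2_comm]
  have hlim : ∀ p, MapClusterPt p atTop (fun n => u (φ n) t) → ∀ q : ℚ,
      W2 (x q) p ≤ C * Real.sqrt |t - q| := by
    intro p hp q
    obtain ⟨F, hF, hFp⟩ := mapClusterPt_iff_ultrafilter.1 hp
    have hb : Tendsto (fun n => C * Real.sqrt (|t - projIcc 0 T hT.le (q : ℝ)| + δ (φ n))) F
        (𝓝 (C * Real.sqrt (|t - projIcc 0 T hT.le (q : ℝ)| + 0))) :=
      (((hδφ.mono_left hF).const_add _).sqrt).const_mul C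
    refine (W2_le_of_tendsto ((hx q).mono_left hF) hFp hb (Eventually.of_forall fun n =>
      hsymm (φ n) _ _ (projIcc 0 T hT.le (q : ℝ)).2 ht)).trans ?_
    refine mul_le_mul_of_nonneg_left (Real.sqrt_le_sqrt ?_) hC
    rw [add_zero]
    have h1 : t = projIcc 0 T hT.le t := by rw [projIcc_of_mem hT.le ht]
    conv_lhs => rw [h1]
    exact abs_projIcc_sub_projIcc hT.le
  obtain ⟨p, hp⟩ := exists_clusterPt_of_compactSpace (Filter.map (fun n => u (φ n) t) atTop)
  refine ⟨p, le_nhds_of_unique_clusterPt fun p' hp' => ?_⟩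
  refine eq_of_W2_eq_zero (le_antisymm ?_ (W2_nonneg _ _))
  have hle : ∀ q : ℚ, W2 p' p ≤ 2 * (C * Real.sqrt |t - q|) := fun q => by
    have h1 := hlim p hp q
    have h2 := hlim p' hp' q
    rw [W2_comm] at h2
    linarith [W2_triangle p' (x q) p]
  have hcont : Continuous (fun y : ℝ => 2 * (C * Real.sqrt |t - y|)) := by fun_prop
  have := Rat.denseRange_cast.induction_on (p := fun y : ℝ => W2 p' p ≤ 2 * (C * Real.sqrt |t - y|))
    t (isClosed_le continuous_const hcont) hle
  simpa using this

/-- A weak limit of the speeds is a speed for the limit curve. -/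
theorem exists_subseq_tendsto_isAC2 (hT : 0 < T) {u : ℕ → ℝ → SphereProb d}
    {V : ℕ → Lp ℝ 2 (volume : Measure ℝ)} {C : ℝ} (hV : ∀ n, ‖V n‖ ≤ C)
    {δ : ℕ → ℝ} (hδ0 : ∀ n, 0 ≤ δ n) (hδ : Tendsto δ atTop (𝓝 0))
    (h : ∀ n s r, s ≤ r → r ≤ T → W2 (u n s) (u n r) ≤ ∫ x in s..(r + δ n), V n x) :
    ∃ φ : ℕ → ℕ, StrictMono φ ∧ ∃ u' : ℝ → SphereProb d, IsAC2 T u' ∧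
      ∀ t ∈ Icc 0 T, Tendsto (fun n => u (φ n) t) atTop (𝓝 (u' t)) := by
  have hC : 0 ≤ C := (norm_nonneg _).trans (hV 0)
  obtain ⟨φ, hφ, hlim⟩ := exists_subseq_tendsto hT hC hδ fun n s r _ hsr hr =>
    (h n s r hsr hr).trans ((intervalIntegral_le_norm_mul_sqrt (V n)
      (by linarith [hδ0 n])).trans (mul_le_mul_of_nonneg_right (hV n) (Real.sqrt_nonneg _)))
  have hlim' : ∀ t, ∃ p, t ∈ Icc 0 T → Tendsto (fun n => u (φ n) t) atTop (𝓝 p) := fun t => by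
    by_cases ht : t ∈ Icc 0 T
    · obtain ⟨p, hp⟩ := hlim t ht
      exact ⟨p, fun _ => hp⟩
    · exact ⟨u 0 0, fun h => absurd h ht⟩
  -- the values outside `[0, T]` are irrelevant
  choose u' hu' using hlim'
  refine ⟨φ, hφ, u', ?_, hu'⟩
  have hF : (hyperfilter ℕ : Filter ℕ) ≤ atTop := Nat.hyperfilter_le_atTop
  obtain ⟨m, hm⟩ := exists_weak_limit (V := fun n => V (φ n)) (fun n => hV (φ n)) (hyperfilter ℕ)
  refine ⟨m, (Lp.memLp m).restrict _, fun s r hs hsr hr => ?_⟩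
  have hδφ : Tendsto (fun n => C * Real.sqrt (δ (φ n))) (hyperfilter ℕ) (𝓝 0) := by
    have := ((hδ.comp hφ.tendsto_atTop).mono_left hF).sqrt.const_mul C
    simpa using this
  have hb : Tendsto (fun n => (∫ x in s..r, V (φ n) x) + C * Real.sqrt (δ (φ n))) (hyperfilter ℕ)
      (𝓝 (∫ x in s..r, m x)) := by
    have h1 := hm (indicatorConstLp 2 (measurableSet_Ioc (a := s) (b := r))
      measure_Ioc_lt_top.ne (1 : ℝ))
    simp_rw [← intervalIntegral_eq_inner _ hsr] at h1
    simpa using h1.add hδφ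
  refine W2_le_of_tendsto ((hu' s ⟨hs, hsr.trans hr⟩).mono_left hF)
    ((hu' r ⟨hs.trans hsr, hr⟩).mono_left hF) hb (Eventually.of_forall fun n => ?_)
  have hint : ∀ a b : ℝ, IntervalIntegrable (V (φ n)) volume a b := fun a b =>
    (((Lp.memLp (V (φ n))).locallyIntegrable one_le_two).integrableOn_isCompact
      isCompact_uIcc).intervalIntegrable
  refine (h (φ n) s r hsr hr).trans ?_
  rw [← intervalIntegral.integral_add_adjacent_intervals (hint s r) (hint r _)]
  refine add_le_add_right ((intervalIntegral_le_norm_mul_sqrt (V (φ n))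
    (by linarith [hδ0 (φ n)])).trans ?_) _
  rw [add_sub_cancel_left]
  exact mul_le_mul_of_nonneg_right (hV _) (Real.sqrt_nonneg _)

end Compactness

/-! ### Convergence of the minimizing movement scheme -/

theorem mainTheorem9 (d α ξ : ℕ) (T : ℝ) (hT : 0 < T)
    (f : EuclideanSpace ℝ (Fin α) → ℝ → EuclideanSpace ℝ (Fin α))
    (g : EuclideanSpace ℝ (Fin α) → ℝ → Matrix (Fin α) (Fin ξ) ℝ)
    (hfg : AdmissibleCoefficients T f g)
    (Θ : ℝ → ProbabilityMeasure (EuclideanSpace ℝ (Fin α)))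
    (hΘ : IsWeightFlow T f g Θ)
    (K : UnitSphere d → UnitSphere d → EuclideanSpace ℝ (Fin α) → ℝ)
    (hK : AdmissibleKernel K)
    (u₀ : SphereProb d)
    (τ : ℕ → TimePartition T)
    (hτ : Tendsto (fun n => (τ n).mesh) atTop (𝓝 0))
    (σ : ℕ → ℕ → ℝ)
    -- the penalization is by the current step, or by the mesh size as long as the points of the
    -- partitions do not accumulate at the scale of the mesh
    (hσ : (∀ n, ∀ k < (τ n).N, σ n k = (τ n).pt (k + 1) - (τ n).pt k) ∨
      ((∀ n, ∀ k < (τ n).N, σ n k = (τ n).mesh) ∧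
        ∃ Λ : ℝ, ∀ n, ∀ s r : ℝ, 0 ≤ s → s ≤ r → r ≤ T →
          ((τ n).countIoc s r : ℝ) ≤ Λ * (1 + (r - s) / (τ n).mesh)))
    (U : ℕ → ℕ → SphereProb d)
    (hU : ∀ n, IsMinimizingMovement (interactionEnergy K Θ) (τ n) (σ n) u₀ (U n)) :
    (∃ C : ℝ, ∀ n, ∑ k ∈ Finset.range (τ n).N,
      σ n k * (W2 (U n (k + 1)) (U n k) / σ n k) ^ 2 ≤ C) ∧
    ∃ φ : ℕ → ℕ, StrictMono φ ∧ ∃ u : ℝ → SphereProb d, IsAC2 T u ∧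
      ∀ t ∈ Icc 0 T,
        Tendsto (fun n => (τ (φ n)).interp (U (φ n)) t) atTop (𝓝 (u t)) := by
  obtain ⟨M, c, hc, hM, hE⟩ := exists_energy_bounds hT hfg hΘ hK u₀
  have hpos : ∀ n, ∀ k < (τ n).N, 0 < σ n k := by
    intro n k hk
    rcases hσ with hσ | ⟨hσ, -⟩
    · rw [hσ n k hk]
      exact sub_pos.2 ((τ n).pt_lt k hk)
    · rw [hσ n k hk]
      exact (τ n).mesh_pos hk
  have hle : ∀ n, ∀ k < (τ n).N, σ n k ≤ (τ n).mesh := by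
    intro n k hk
    rcases hσ with hσ | ⟨hσ, -⟩
    · rw [hσ n k hk]
      exact (τ n).sub_le_mesh hk
    · exact (hσ n k hk).le
  have hoverlap : ∃ A : ℝ, ∀ n t, (overlap (τ n) (σ n) t : ℝ) ≤ A := by
    rcases hσ with hσ | ⟨hσ, Λ, hΛ⟩
    · exact ⟨1, fun n t => by exact_mod_cast overlap_le_one (hσ n) t⟩
    · exact ⟨3 * |Λ| + 1, fun n t => overlap_le_of_countIoc (hσ n) (hΛ n) hT t⟩
  obtain ⟨A, hA⟩ := hoverlap
  have hspeed : ∀ n, ∑ k ∈ Finset.range (τ n).N,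
      σ n k * (W2 (U n (k + 1)) (U n k) / σ n k) ^ 2 ≤ 4 * M + 2 * ∫ x in (0 : ℝ)..T, c x :=
    fun n => (hU n).sum_speed_sq_le (hpos n) hc hM hE
  refine ⟨⟨_, hspeed⟩, ?_⟩
  choose V hV hVi using fun n => exists_discreteSpeed_Lp (hpos n) (hle n) (hA n) (hspeed n)
  exact exists_subseq_tendsto_isAC2 hT hV (fun n => (τ n).mesh_nonneg) hτ hVi
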